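/- \textbf{Theorem 3.} In \textsc{3-Partitioned-3-SAT} the input is a 3-CNF formula $\psi$ (a set of distinct clauses, each with at most three literals) over $N=3n$ variables, together with a partition of the variables into three sets $X^{\alpha},X^{\beta},X^{\gamma}$ of size $n$ each, such that no clause contains more than one variable from each of $X^{\alpha},X^{\beta},X^{\gamma}$; the question is whether $\psi$ is satisfiable. In \textsc{Metric Dimension} the input is a graph $G$ and a positive integer $k$; the question is whether there is a set $S\subseteq V(G)$ with $|S|\le k$ such that for any two distinct vertices $u,v\in V(G)$ there is $w\in S$ with $d(w,u)\ne d(w,v)$. Let $\mathrm{vc}(G)$ denote the size of a minimum vertex cover of $G$. There is an algorithm that, given an instance $\psi$ of \textsc{3-Partitioned-3-SAT} on $N\ge 1$ variables, runs in $2^{O(\sqrt N)}$ time and constructs an equivalent instance $(G,k)$ of \textsc{Metric Dimension} (that is, $\psi$ is satisfiable if and only if $(G,k)$ is a yes-instance) such that $\mathrm{vc}(G)+k=O(\sqrt N)$ and $|V(G)|=2^{O(\sqrt N)}$. -/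

import Mathlib

/-! ## Random access machines with unit-cost addition and subtraction

Programs act on finitely many registers (those that occur in the program), a random-access memory
whose cells hold natural numbers, and a write-only output tape.  The only arithmetic operations are
addition and truncated subtraction, so that the step count is polynomially related to the running
time of Turing machines. -/

namespace RAM

/-- Expressions: constants, registers, sums, truncated differences, and memory reads. -/
inductive Expr where
  | const (v : ℕ)
  | reg (r : ℕ)
  | add (a b : Expr)
  | sub (a b : Expr)
  | load (addr : Expr)

/-- Structured programs. -/
inductive Prog where
  | skip
  /-- put the value of `e` into register `r` -/
  | assign (r : ℕ) (e : Expr)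
  /-- put the value of `e` into the memory cell whose address is the value of `addr` -/
  | store (addr e : Expr)
  /-- append the value of `e` to the output -/
  | emit (e : Expr)
  | seq (p q : Prog)
  /-- run `p` if the value of `e` is nonzero, and `q` otherwise -/
  | branch (e : Expr) (p q : Prog)
  /-- run `p` again and again, as long as the value of `e` is nonzero -/
  | loop (e : Expr) (p : Prog)

/-- Configurations: contents of the registers and of the memory, and the output so far. -/
structure State where
  reg : ℕ → ℕ
  mem : ℕ → ℕ
  out : List ℕ

namespace Expr

/-- The value of an expression. -/
def eval : Expr → State → ℕ
  | const v, _ => v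
  | reg r, s => s.reg r
  | add a b, s => a.eval s + b.eval s
  | sub a b, s => a.eval s - b.eval s
  | load a, s => s.mem (a.eval s)

/-- The number of steps that the evaluation takes: one for each operation and each operand. -/
def cost : Expr → ℕ
  | const _ => 1
  | reg _ => 1
  | add a b => a.cost + b.cost + 1
  | sub a b => a.cost + b.cost + 1
  | load a => a.cost + 1

end Expr

/-- `Run p s s' t`: the program `p`, started in the configuration `s`, halts in the
configuration `s'` after exactly `t` steps. -/
inductive Run : Prog → State → State → ℕ → Prop where
  | skip (s : State) : Run .skip s s 1
  | assign (r : ℕ) (e : Expr) (s : State) :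
      Run (.assign r e) s { s with reg := Function.update s.reg r (e.eval s) } (e.cost + 1)
  | store (a e : Expr) (s : State) :
      Run (.store a e) s { s with mem := Function.update s.mem (a.eval s) (e.eval s) }
        (a.cost + e.cost + 1)
  | emit (e : Expr) (s : State) :
      Run (.emit e) s { s with out := s.out ++ [e.eval s] } (e.cost + 1)
  | seq {p q : Prog} {s s' s'' : State} {t t' : ℕ} :
      Run p s s' t → Run q s' s'' t' → Run (.seq p q) s s'' (t + t')
  | branch_pos {e : Expr} {p q : Prog} {s s' : State} {t : ℕ} :
      e.eval s ≠ 0 → Run p s s' t → Run (.branch e p q) s s' (e.cost + 1 + t)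
  | branch_neg {e : Expr} {p q : Prog} {s s' : State} {t : ℕ} :
      e.eval s = 0 → Run q s s' t → Run (.branch e p q) s s' (e.cost + 1 + t)
  | loop_done {e : Expr} {p : Prog} {s : State} :
      e.eval s = 0 → Run (.loop e p) s s (e.cost + 1)
  | loop_step {e : Expr} {p : Prog} {s s' s'' : State} {t t' : ℕ} :
      e.eval s ≠ 0 → Run p s s' t → Run (.loop e p) s' s'' t' →
        Run (.loop e p) s s'' (e.cost + 1 + t + t')

/-- The initial configuration on input `w`: the input is in the memory cells from address `0` on,
its length is in register `0`, everything else is zero, and the output is empty. -/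
def start (w : List ℕ) : State where
  reg := fun r => if r = 0 then w.length else 0
  mem := fun i => w.getD i 0
  out := []

/-- The program `p`, on input `w`, halts after exactly `t` steps with output `o`. -/
def OutputsIn (p : Prog) (w o : List ℕ) (t : ℕ) : Prop :=
  ∃ s, Run p (start w) s t ∧ s.out = o

end RAM

/-! ## 3-Partitioned-3-SAT -/

/-- Literals over the `3 * n` variables `x_{δ,i}`, with `δ : Fin 3` the part of the partition and
`i : Fin n` the index inside this part; `positive` is the sign of the literal. -/
structure Literal (n : ℕ) where
  part : Fin 3
  index : Fin n
  positive : Bool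

/-- Instances: a set of clauses, written as a list without repetition, over three disjoint sets of
`n` variables each. -/
structure PartitionedSAT where
  n : ℕ
  clauses : List (List (Literal n))
  /-- no clause is listed twice -/
  nodup : clauses.Nodup
  /-- a clause has at most three literals -/
  length_le : ∀ C ∈ clauses, C.length ≤ 3
  /-- a clause contains at most one variable from each of the three parts -/
  one_per_part : ∀ C ∈ clauses, ∀ l ∈ C, ∀ l' ∈ C, l.part = l'.part → l.index = l'.index

namespace PartitionedSAT

/-- The number `N` of variables. -/
def numVars (ψ : PartitionedSAT) : ℕ := 3 * ψ.n

/-- Some truth assignment makes at least one literal of every clause true. -/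
def Satisfiable (ψ : PartitionedSAT) : Prop :=
  ∃ π : Fin 3 → Fin ψ.n → Bool, ∀ C ∈ ψ.clauses, ∃ l ∈ C, π l.part l.index = l.positive

/-- The encoding of an instance: the size of the parts, the number of clauses, and then, for each
clause, its length followed by its literals, three numbers each (part, index, sign). -/
def encode (ψ : PartitionedSAT) : List ℕ :=
  ψ.n :: ψ.clauses.length :: ψ.clauses.flatMap fun C =>
    C.length :: C.flatMap fun l =>
      [(l.part : ℕ), (l.index : ℕ), if l.positive then 1 else 0]

end PartitionedSAT

/-! ## Metric Dimension -/

/-- Every two distinct vertices have different distances to some vertex of `S`. Vertices in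
different components have infinite distance. -/
def SimpleGraph.IsResolvingSet {V : Type*} (G : SimpleGraph V) (S : Set V) : Prop :=
  ∀ u v, u ≠ v → ∃ w ∈ S, G.edist w u ≠ G.edist w v

/-- Instances of Metric Dimension: a finite graph and a positive integer. -/
structure MetricDimensionInstance where
  numVerts : ℕ
  graph : SimpleGraph (Fin numVerts)
  k : ℕ
  k_pos : 0 < k

namespace MetricDimensionInstance

/-- The graph has a resolving set of size at most `k`. -/
def IsYes (I : MetricDimensionInstance) : Prop :=
  ∃ S : Finset (Fin I.numVerts), S.card ≤ I.k ∧ I.graph.IsResolvingSet (S : Set (Fin I.numVerts))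

open Classical in
/-- The encoding of an instance: `k`, the number of vertices, and the adjacency matrix, row by
row. -/
noncomputable def encode (I : MetricDimensionInstance) : List ℕ :=
  I.k :: I.numVerts :: (List.finRange I.numVerts).flatMap fun u =>
    (List.finRange I.numVerts).map fun v => if I.graph.Adj u v then 1 else 0

end MetricDimensionInstance

/-! Cut each part into `b` buckets of `b` variables, with `b` of order `√n`. A bucket has only `2 ^
b` assignments, so there is room for a vertex for each of them, and the budget is chosen so that a
resolving set can afford only one vertex per bucket.

Each of the `75 * b + 1` labels has a pair of twins, of which every resolving set contains one. The
twins of label `2 ^ i` see exactly the vertices with binary digit `i` set, so one twin per label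
already resolves everything except the twin pairs, a pair for each bucket and a pair for each
clause. A bucket pair is resolved only by its members and by assignment vertices of that bucket
(`Layout.edist_bucket_pair`). Hence the budget, labels plus buckets, is used up exactly, and the
clause pairs are left to the chosen assignment vertices.

Clauses and assignments communicate through `9 * b` portals. For each part there is a portal for
every bucket, and one for every position and truth value. One copy of a clause sees all portals; at
the other copy, a literal deletes the edges to the portal of its bucket and to all position portals
of its part, except the one recording the value that falsifies it. An assignment vertex is at
distance two from the full copy, and at distance two from the reduced copy unless all its portals
are deleted there. So it resolves the pair exactly if it belongs to the bucket of some literal and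
makes that literal true (`removed_of_meets_iff`).

Forced vertices, portals, bucket vertices and the hub cover all edges, and there are `O(b)` of them.
The kind, the parameters and the neighbours of a vertex are read off the digits of its number, so
adjacency is decided in time polynomial in the number of vertices, which is `2 ^ O(b)`; the machine
prints the matrix entry by entry (`exists_program`). -/

namespace SimpleGraph

/-! ### Distances up to three. -/

variable {V : Type*} {G : SimpleGraph V} {u v w : V}

/-- Two vertices within distance three of `w` have the same distance to `w` as soon as they agree on
being adjacent to `w` and on having a common neighbour with `w`. -/
theorem edist_eq_of_agree (hu : w ≠ u) (hv : w ≠ v) (h1 : G.Adj w u ↔ G.Adj w v)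
    (h2 : (∃ z, G.Adj w z ∧ G.Adj z u) ↔ ∃ z, G.Adj w z ∧ G.Adj z v)
    (hu3 : G.edist w u ≤ 3) (hv3 : G.edist w v ≤ 3) : G.edist w u = G.edist w v := by
  have key : ∀ {x : V}, w ≠ x → G.edist w x ≤ 3 →
      G.edist w x = 1 ∧ G.Adj w x ∨
      G.edist w x = 2 ∧ ¬ G.Adj w x ∧ (∃ z, G.Adj w z ∧ G.Adj z x) ∨
      G.edist w x = 3 ∧ ¬ G.Adj w x ∧ ¬ ∃ z, G.Adj w z ∧ G.Adj z x := by
    intro x hx h3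
    by_cases ha : G.Adj w x
    · exact Or.inl ⟨edist_eq_one_iff_adj.2 ha, ha⟩
    by_cases hc : ∃ z, G.Adj w z ∧ G.Adj z x
    · refine Or.inr (Or.inl ⟨edist_eq_two_iff.2 ⟨hx, ha, ?_⟩, ha, hc⟩)
      obtain ⟨z, hz, hz'⟩ := hc
      exact ⟨z, hz, hz'.symm⟩
    · refine Or.inr (Or.inr ⟨le_antisymm h3 ?_, ha, hc⟩)
      have : 2 < G.edist w x := by
        rw [two_lt_edist_iff]
        refine ⟨hx, ha, ?_⟩
        exact Set.eq_empty_iff_forall_notMem.2 fun z hz => hc ⟨z, hz.1, SimpleGraph.Adj.symm hz.2⟩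
      exact Order.add_one_le_of_lt this
  rcases key hu hu3 with ⟨e, a⟩ | ⟨e, a, c⟩ | ⟨e, a, c⟩ <;>
    rcases key hv hv3 with ⟨e', a'⟩ | ⟨e', a', c'⟩ | ⟨e', a', c'⟩ <;> 
    first
    | (rw [e, e']; done) | exact absurd (h1.1 a) a' | exact absurd (h1.2 a') a
    | exact absurd (h2.1 c) c' | exact absurd (h2.2 c') c

theorem edist_le_two_of_adj_adj {z : V} (h : G.Adj w z) (h' : G.Adj z u) : G.edist w u ≤ 2 :=
  le_trans (G.edist_le (.cons h (.cons h' .nil))) (by simp)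

theorem edist_le_three_of_adj_adj_adj {y z : V} (h : G.Adj w y) (h' : G.Adj y z)
    (h'' : G.Adj z u) : G.edist w u ≤ 3 :=
  le_trans (G.edist_le (.cons h (.cons h' (.cons h'' .nil)))) (by simp)

end SimpleGraph

/-! ### The graph of a layout and its distances. -/

/-- The vertices of the metric dimension instance. The tag of a vertex is `0` for forced vertices,
`1` for portals, `2` for assignment vertices, `3` for clause vertices, `4` for bucket vertices, `5`
for hubs; `x` and `y` are the parameters and `e` is the copy. -/
structure Layout (V : Type*) (labels : Finset ℕ) (buckets clauses portals assignments : ℕ) where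
  tag : V → ℕ
  x : V → ℕ
  y : V → ℕ
  e : V → Bool
  bit : V → ℕ → Prop
  -- Tag `6` is for surplus vertices, which have no meaningful parameters; their bits alone tell
  -- them apart.
  inj : ∀ u v, tag u = tag v → tag u ≠ 6 → x u = x v → y u = y v → e u = e v → u = v
  y_eq : ∀ u, tag u ≠ 2 → y u = 0
  forced_mem : ∀ u, tag u = 0 → x u ∈ labels
  portal_lt : ∀ u, tag u = 1 → x u < portals
  assign_lt : ∀ u, tag u = 2 → x u < buckets ∧ y u < assignments
  clause_lt : ∀ u, tag u = 3 → x u < clauses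
  bucket_lt : ∀ u, tag u = 4 → x u < buckets
  hub_eq : ∀ u, tag u = 5 → x u = 0
  forced_exists : ∀ a ∈ labels, ∀ c, ∃ u, tag u = 0 ∧ x u = a ∧ e u = c
  portal_exists : ∀ p < portals, ∃ u, tag u = 1 ∧ x u = p
  assign_exists : ∀ g < buckets, ∀ l < assignments, ∃ u, tag u = 2 ∧ x u = g ∧ y u = l ∧ e u = false
  clause_exists : ∀ r < clauses, ∀ c, ∃ u, tag u = 3 ∧ x u = r ∧ e u = c
  bucket_exists : ∀ g < buckets, ∀ c, ∃ u, tag u = 4 ∧ x u = g ∧ e u = c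
  hub_exists : ∃ u, tag u = 5
  bit_forced : ∀ u, tag u = 0 → ∀ a ∈ labels, (bit u a ↔ a = x u)
  bit_pair : ∀ u v, tag u = tag v → x u = x v → tag u = 3 ∨ tag u = 4 → ∀ a ∈ labels,
    (bit u a ↔ bit v a)
  -- No forced vertex is a common neighbour of an assignment and a clause, so only portals can put
  -- them at distance two.
  bit_disjoint : ∀ u v, tag u = 2 → tag v = 3 → ∀ a ∈ labels, bit u a → ¬ bit v a
  -- Assignment vertices miss the hub; a forced neighbour brings them within distance two of it.
  bit_assign : ∀ u, tag u = 2 → ∃ a ∈ labels, bit u a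
  bit_hub : ∀ u, tag u = 5 → ∀ a ∈ labels, bit u a
  bit_sep : ∀ u v, (∀ a ∈ labels, (bit u a ↔ bit v a)) → u = v ∨
    (e u ≠ e v ∧ tag u = tag v ∧ x u = x v ∧ (tag u = 0 ∨ tag u = 3 ∨ tag u = 4))

namespace Layout

variable {V : Type*} {labels : Finset ℕ} {buckets clauses portals assignments : ℕ}
  (Y : Layout V labels buckets clauses portals assignments)
  (meets : ℕ → ℕ → ℕ → Prop) (removed : ℕ → ℕ → Prop)

/-- The two copies of a clause or of a bucket differ only in the third and fourth lines. The hub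
must avoid assignment vertices, since it would put them at distance two from every clause vertex. -/
def Rel (u v : V) : Prop :=
  (Y.tag u = 0 ∧ Y.bit v (Y.x u)) ∨
  (Y.tag u = 1 ∧ Y.tag v = 2 ∧ meets (Y.x u) (Y.x v) (Y.y v)) ∨
  (Y.tag u = 1 ∧ Y.tag v = 3 ∧ (Y.e v = true ∨ ¬ removed (Y.x v) (Y.x u))) ∨
  (Y.tag u = 4 ∧ Y.e u = false ∧ Y.tag v = 2 ∧ Y.x u = Y.x v) ∨
  (Y.tag u = 5 ∧ Y.tag v ≠ 2)

def graph : SimpleGraph V where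
  Adj u v := u ≠ v ∧ (Y.Rel meets removed u v ∨ Y.Rel meets removed v u)
  symm := ⟨fun _ _ h => ⟨h.1.symm, h.2.symm⟩⟩
  loopless := ⟨fun _ h => h.1 rfl⟩

variable {Y meets removed} {u v w : V}

/-- Edges at a forced vertex that come from the other end start at a forced vertex or at the hub;
`bit_forced` and `bit_hub` make these agree with the bits. -/
theorem adj_of_forced (h : Y.tag w = 0) (hu : w ≠ u) :
    (Y.graph meets removed).Adj w u ↔ Y.bit u (Y.x w) := by
  have hw := Y.forced_mem w h
  simp only [graph, Rel, h]
  constructor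
  · rintro ⟨-, h1 | h1⟩
    · simpa using h1
    · simp only [OfNat.zero_ne_ofNat, false_and, and_false, false_or, ne_eq, not_false_eq_true,
        and_true] at h1
      rcases h1 with ⟨h1, h2⟩ | h1
      · rw [Y.bit_forced u h1 _ hw]
        rw [Y.bit_forced w h _ (Y.forced_mem u h1)] at h2
        exact h2.symm
      · exact Y.bit_hub u h1 _ hw
  · intro h1
    exact ⟨hu, Or.inl (Or.inl ⟨trivial, h1⟩)⟩

theorem adj_hub (h : Y.tag w = 5) (hu : w ≠ u) (h2 : Y.tag u ≠ 2) :
    (Y.graph meets removed).Adj w u :=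
  ⟨hu, Or.inl (Or.inr (Or.inr (Or.inr (Or.inr ⟨h, h2⟩))))⟩

theorem tag_of_adj_assign (h : Y.tag w = 2) (hu : (Y.graph meets removed).Adj w u) :
    Y.tag u = 0 ∨ Y.tag u = 1 ∨ Y.tag u = 4 := by
  simp [graph, Rel, h] at hu
  tauto

theorem tag_of_adj_clause (h : Y.tag w = 3) (hu : (Y.graph meets removed).Adj w u) :
    Y.tag u = 0 ∨ Y.tag u = 1 ∨ Y.tag u = 5 := by
  simp [graph, Rel, h] at hu
  tauto

theorem adj_portal_assign (h : Y.tag w = 1) (hu : Y.tag u = 2) :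
    (Y.graph meets removed).Adj w u ↔ meets (Y.x w) (Y.x u) (Y.y u) := by
  have : w ≠ u := by rintro rfl; omega
  simp [graph, Rel, h, hu, this]

theorem adj_portal_clause (h : Y.tag w = 1) (hu : Y.tag u = 3) :
    (Y.graph meets removed).Adj w u ↔ (Y.e u = true ∨ ¬ removed (Y.x u) (Y.x w)) := by
  have : w ≠ u := by rintro rfl; omega
  simp [graph, Rel, h, hu, this]

theorem adj_bucket_assign (h : Y.tag w = 4) (hu : Y.tag u = 2) :
    (Y.graph meets removed).Adj w u ↔ (Y.e w = false ∧ Y.x w = Y.x u) := by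
  have : w ≠ u := by rintro rfl; omega
  simp [graph, Rel, h, hu, this]

theorem adj_bucket (h : Y.tag u = 4) (h2 : Y.tag w ≠ 2) (hu : w ≠ u) :
    (Y.graph meets removed).Adj w u ↔ (Y.tag w = 0 ∧ Y.bit u (Y.x w) ∨ Y.tag w = 5) := by
  simp [graph, Rel, h, h2, hu]

/-- Both have the same neighbours outside the pair, so a walk to one of them can be stopped on
reaching the pair and its last edge redirected to the other. -/
theorem edist_forced_pair (hu : Y.tag u = 0) (hv : Y.tag v = 0) (h : Y.x u = Y.x v)
    (hwu : w ≠ u) (hwv : w ≠ v) :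
    (Y.graph meets removed).edist w u = (Y.graph meets removed).edist w v := by
  have adj_iff : ∀ z, z ≠ u → z ≠ v →
      ((Y.graph meets removed).Adj z u ↔ (Y.graph meets removed).Adj z v) := by
    intro z hzu hzv
    rw [SimpleGraph.adj_comm, adj_of_forced hu hzu.symm, SimpleGraph.adj_comm,
      adj_of_forced hv hzv.symm, h]
  have walk : ∀ {s t : V}, (∀ z, z ≠ s → z ≠ t →
      ((Y.graph meets removed).Adj z s → (Y.graph meets removed).Adj z t)) →
      ∀ {w : V} (p : (Y.graph meets removed).Walk w s), w ≠ s → w ≠ t →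
      ∃ q : (Y.graph meets removed).Walk w t, q.length ≤ p.length := by
    intro s t hst w p
    induction p with
    | nil => intro h; exact absurd rfl h
    | @cons a b c hab p ih =>
      intro h1 h2
      by_cases hbs : b = c
      · subst hbs
        exact ⟨.cons (hst _ h1 h2 hab) .nil, by simp⟩
      by_cases hbt : b = t
      · subst hbt
        exact ⟨.cons hab .nil, by simp⟩
      obtain ⟨q, hq⟩ := ih hst hbs hbt
      exact ⟨.cons hab q, by simpa using hq⟩
  have le : ∀ {s t : V}, (∀ z, z ≠ s → z ≠ t →
      ((Y.graph meets removed).Adj z s → (Y.graph meets removed).Adj z t)) →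
      w ≠ s → w ≠ t → (Y.graph meets removed).edist w t ≤ (Y.graph meets removed).edist w s := by
    intro s t hst h1 h2
    by_cases htop : (Y.graph meets removed).edist w s = ⊤
    · simp [htop]
    obtain ⟨p, hp⟩ := SimpleGraph.exists_walk_of_edist_ne_top htop
    obtain ⟨q, hq⟩ := walk hst p h1 h2
    rw [← hp]
    exact (SimpleGraph.edist_le q).trans (by exact_mod_cast hq)
  exact le_antisymm (le (fun z h1 h2 => (adj_iff z h2 h1).2) hwv hwu)
    (le (fun z h1 h2 => (adj_iff z h1 h2).1) hwu hwv)

/-- The hub bounds the distances by two, or by three from an assignment vertex, so only adjacency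
and common neighbours matter. The two copies differ only in their edges to their own assignment
vertices, and no vertex of another bucket's assignments uses these in its first two steps. -/
theorem edist_bucket_pair (hu : Y.tag u = 4) (hv : Y.tag v = 4) (h : Y.x u = Y.x v)
    (hwu : w ≠ u) (hwv : w ≠ v) (hw : Y.tag w = 2 → Y.x w ≠ Y.x u) :
    (Y.graph meets removed).edist w u = (Y.graph meets removed).edist w v := by
  obtain ⟨c, hc⟩ := Y.hub_exists
  have hcu : c ≠ u := by rintro rfl; omega
  have hcv : c ≠ v := by rintro rfl; omega
  have acu : (Y.graph meets removed).Adj c u := adj_hub hc hcu (by omega)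
  have acv : (Y.graph meets removed).Adj c v := adj_hub hc hcv (by omega)
  have agree : ∀ z, z ≠ u → z ≠ v → (Y.tag z = 2 → Y.x z ≠ Y.x u) →
      ((Y.graph meets removed).Adj z u ↔ (Y.graph meets removed).Adj z v) := by
    intro z hzu hzv hz
    by_cases h2 : Y.tag z = 2
    · rw [SimpleGraph.adj_comm, adj_bucket_assign hu h2, SimpleGraph.adj_comm,
        adj_bucket_assign hv h2, ← h]
      have := hz h2
      constructor <;> rintro ⟨-, h'⟩ <;> exact absurd h'.symm this
    · rw [adj_bucket hu h2 hzu, adj_bucket hv h2 hzv]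
      by_cases h0 : Y.tag z = 0
      · simp [h0, Y.bit_pair u v (hu.trans hv.symm) h (Or.inr hu) _ (Y.forced_mem z h0)]
      · simp [h0]
  by_cases hwc : w = c
  · subst hwc
    rw [SimpleGraph.edist_eq_one_iff_adj.2 acu, SimpleGraph.edist_eq_one_iff_adj.2 acv]
  by_cases h2 : Y.tag w = 2
  · obtain ⟨a, ha, hwa⟩ := Y.bit_assign w h2
    obtain ⟨f, hf, hfa, -⟩ := Y.forced_exists a ha false
    have hwf : (Y.graph meets removed).Adj w f := by
      refine SimpleGraph.Adj.symm ?_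
      rw [adj_of_forced hf (by rintro rfl; omega), hfa]
      exact hwa
    have hfc : (Y.graph meets removed).Adj f c :=
      (adj_hub hc (by rintro rfl; omega) (by omega)).symm
    refine SimpleGraph.edist_eq_of_agree hwu hwv (agree w hwu hwv hw) ?_
      (SimpleGraph.edist_le_three_of_adj_adj_adj hwf hfc acu)
      (SimpleGraph.edist_le_three_of_adj_adj_adj hwf hfc acv)
    have common : ∀ z, (Y.graph meets removed).Adj w z →
        ((Y.graph meets removed).Adj z u ↔ (Y.graph meets removed).Adj z v) := by
      intro z hz
      have := tag_of_adj_assign h2 hz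
      refine agree z ?_ ?_ (by omega)
      · rintro rfl
        exact hw h2 ((adj_bucket_assign hu h2).1 hz.symm).2.symm
      · rintro rfl
        exact hw h2 (h.trans ((adj_bucket_assign hv h2).1 hz.symm).2).symm
    exact exists_congr fun z => and_congr_right (common z)
  · have hwc' : (Y.graph meets removed).Adj w c := (adj_hub hc (Ne.symm hwc) h2).symm
    exact SimpleGraph.edist_eq_of_agree hwu hwv (agree w hwu hwv hw)
      ⟨fun _ => ⟨c, hwc', acv⟩, fun _ => ⟨c, hwc', acu⟩⟩
      ((SimpleGraph.edist_le_two_of_adj_adj hwc' acu).trans (by norm_num))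
      ((SimpleGraph.edist_le_two_of_adj_adj hwc' acv).trans (by norm_num))

theorem not_adj_assign_clause (hw : Y.tag w = 2) (hu : Y.tag u = 3) :
    ¬ (Y.graph meets removed).Adj w u := by
  intro h
  have := tag_of_adj_assign hw h
  omega

/-- The hub is a common neighbour of all three vertices, so adjacency alone decides the distance.
Bucket vertices see no clause, and forced vertices see only the bits, which the pair shares. -/
theorem edist_clause_pair (hu : Y.tag u = 3) (hv : Y.tag v = 3) (h : Y.x u = Y.x v)
    (hw : Y.tag w = 0 ∨ Y.tag w = 4) :
    (Y.graph meets removed).edist w u = (Y.graph meets removed).edist w v := by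
  obtain ⟨c, hc⟩ := Y.hub_exists
  have acu : (Y.graph meets removed).Adj c u := adj_hub hc (by rintro rfl; omega) (by omega)
  have acv : (Y.graph meets removed).Adj c v := adj_hub hc (by rintro rfl; omega) (by omega)
  have awc : (Y.graph meets removed).Adj w c :=
    (adj_hub hc (by rintro rfl; omega) (by omega)).symm
  have hwu : w ≠ u := by rintro rfl; omega
  have hwv : w ≠ v := by rintro rfl; omega
  refine SimpleGraph.edist_eq_of_agree hwu hwv ?_ ⟨fun _ => ⟨c, awc, acv⟩, fun _ => ⟨c, awc, acu⟩⟩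
      ((SimpleGraph.edist_le_two_of_adj_adj awc acu).trans (by norm_num))
      ((SimpleGraph.edist_le_two_of_adj_adj awc acv).trans (by norm_num))
  rcases hw with hw | hw
  · rw [adj_of_forced hw hwu, adj_of_forced hw hwv,
      Y.bit_pair u v (hu.trans hv.symm) h (Or.inl hu) _ (Y.forced_mem w hw)]
  · constructor <;> intro h'
    · have := tag_of_adj_clause hu h'.symm
      omega
    · have := tag_of_adj_clause hv h'.symm
      omega

/-- An assignment vertex has distance two to exactly those clause vertices with which it shares a
portal. -/
theorem edist_assign_clause (hw : Y.tag w = 2) (hu : Y.tag u = 3) :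
    (Y.graph meets removed).edist w u = 2 ↔
      ∃ p < portals, meets p (Y.x w) (Y.y w) ∧ (Y.e u = true ∨ ¬ removed (Y.x u) p) := by
  rw [SimpleGraph.edist_eq_two_iff]
  have hwu : w ≠ u := by rintro rfl; omega
  constructor
  · rintro ⟨-, -, z, hz⟩
    rw [SimpleGraph.mem_commonNeighbors] at hz
    obtain ⟨hwz, huz⟩ := hz
    have h1 := tag_of_adj_assign hw hwz
    have h2 := tag_of_adj_clause hu huz
    have h3 : Y.tag z = 0 ∨ Y.tag z = 1 := by omega
    rcases h3 with h3 | h3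
    · have hwz' := (adj_of_forced h3 hwz.ne.symm).1 hwz.symm
      have huz' := (adj_of_forced h3 huz.ne.symm).1 huz.symm
      exact absurd huz' (Y.bit_disjoint w u hw hu _ (Y.forced_mem z h3) hwz')
    · exact ⟨Y.x z, Y.portal_lt z h3, (adj_portal_assign h3 hw).1 hwz.symm,
        (adj_portal_clause h3 hu).1 huz.symm⟩
  · rintro ⟨p, hp, h1, h2⟩
    obtain ⟨z, hz, rfl⟩ := Y.portal_exists p hp
    refine ⟨hwu, not_adj_assign_clause hw hu, z, ?_⟩
    rw [SimpleGraph.mem_commonNeighbors]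
    exact ⟨((adj_portal_assign hz hw).2 h1).symm, ((adj_portal_clause hz hu).2 h2).symm⟩

/-! ### Resolving sets and a vertex cover. -/

variable (Y meets removed)

theorem exists_choice_of_isResolvingSet
    (hmeets : ∀ g < buckets, ∀ l < assignments, ∃ p < portals, meets p g l)
    (hassign : 0 < assignments) (S : Finset V)
    (hcard : S.card ≤ labels.card + buckets)
    (hS : (Y.graph meets removed).IsResolvingSet (S : Set V)) :
    ∃ L : ℕ → ℕ, (∀ g < buckets, L g < assignments) ∧
      ∀ r < clauses, ∃ g < buckets, ∀ p < portals, meets p g (L g) → removed r p := by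
  classical
  have forced : ∀ a : labels, ∃ w ∈ S, Y.tag w = 0 ∧ Y.x w = a := by
    rintro ⟨a, ha⟩
    obtain ⟨u, hu, hua, hue⟩ := Y.forced_exists a ha false
    obtain ⟨v, hv, hva, hve⟩ := Y.forced_exists a ha true
    obtain ⟨w, hw, hne⟩ := hS u v (by rintro rfl; simp [hue] at hve)
    by_cases hwu : w = u
    · subst hwu; exact ⟨w, hw, hu, hua⟩
    by_cases hwv : w = v
    · subst hwv; exact ⟨w, hw, hv, hva⟩
    exact absurd (edist_forced_pair hu hv (hua.trans hva.symm) hwu hwv) hne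
  have bucket : ∀ g : Fin buckets, ∃ w ∈ S, (Y.tag w = 2 ∨ Y.tag w = 4) ∧ Y.x w = g := by
    rintro ⟨g, hg⟩
    obtain ⟨u, hu, hug, hue⟩ := Y.bucket_exists g hg false
    obtain ⟨v, hv, hvg, hve⟩ := Y.bucket_exists g hg true
    obtain ⟨w, hw, hne⟩ := hS u v (by rintro rfl; simp [hue] at hve)
    by_cases hwu : w = u
    · subst hwu; exact ⟨w, hw, Or.inr hu, hug⟩
    by_cases hwv : w = v
    · subst hwv; exact ⟨w, hw, Or.inr hv, hvg⟩
    by_cases h2 : Y.tag w = 2 ∧ Y.x w = g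
    · exact ⟨w, hw, Or.inl h2.1, h2.2⟩
    refine absurd (edist_bucket_pair hu hv (hug.trans hvg.symm) hwu hwv ?_) hne
    intro h h'
    exact h2 ⟨h, h'.trans hug⟩
  choose f hfS hf0 hfx using forced
  choose b hbS hbt hbx using bucket
  -- Counting: the vertices demanded by labels and buckets are pairwise distinct, so by the
  -- cardinality bound they are all of `S`.
  let F : labels ⊕ Fin buckets → S := Sum.elim (fun a => ⟨f a, hfS a⟩) (fun g => ⟨b g, hbS g⟩)
  have hF : Function.Injective F := by
    rintro (a | g) (a' | g') h <;> simp only [F, Sum.elim_inl, Sum.elim_inr, Subtype.mk.injEq] at h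
    · rw [Sum.inl.injEq]
      apply Subtype.ext
      rw [← hfx a, ← hfx a', h]
    · have h1 := hf0 a
      have h2 := hbt g'
      rw [h] at h1
      omega
    · have h1 := hf0 a'
      have h2 := hbt g
      rw [h] at h2
      omega
    · rw [Sum.inr.injEq]
      apply Fin.ext
      rw [← hbx g, ← hbx g', h]
  have hFs : Function.Surjective F := by
    refine ((Fintype.bijective_iff_injective_and_card F).2 ⟨hF, ?_⟩).2
    refine le_antisymm (Fintype.card_le_of_injective F hF) ?_
    simpa using hcard
  -- If `S` spends the bucket's vertex on a bucket vertex, assignment `0` is a harmless default: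
  -- such a vertex resolves no clause pair.
  refine ⟨fun g => if h : g < buckets then
    (if Y.tag (b ⟨g, h⟩) = 2 then Y.y (b ⟨g, h⟩) else 0) else 0, ?_, ?_⟩
  · intro g hg
    simp only [hg, dif_pos]
    split_ifs with h
    · exact (Y.assign_lt _ h).2
    · exact hassign
  · intro r hr
    obtain ⟨u, hu, hur, hue⟩ := Y.clause_exists r hr false
    obtain ⟨v, hv, hvr, hve⟩ := Y.clause_exists r hr true
    obtain ⟨w, hw, hne⟩ := hS u v (by rintro rfl; simp [hue] at hve)
    obtain ⟨i, hi⟩ := hFs ⟨w, hw⟩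
    have huv : Y.x u = Y.x v := hur.trans hvr.symm
    rcases i with a | g
    · simp only [F, Sum.elim_inl, Subtype.mk.injEq] at hi
      subst hi
      exact absurd (edist_clause_pair hu hv huv (Or.inl (hf0 a))) hne
    · simp only [F, Sum.elim_inr, Subtype.mk.injEq] at hi
      subst hi
      rcases hbt g with h2 | h4
      swap
      · exact absurd (edist_clause_pair hu hv huv (Or.inr h4)) hne
      refine ⟨g, g.2, ?_⟩
      simp only [g.2, dif_pos, Fin.eta, h2, if_true]
      intro p hp hm
      by_contra hr'
      apply hne
      have hl := (Y.assign_lt _ h2).2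
      rw [(edist_assign_clause h2 hu).2 ⟨p, hp, (hbx g).symm ▸ hm, Or.inr (hur.symm ▸ hr')⟩]
      obtain ⟨q, hq, hm'⟩ := hmeets g g.2 _ hl
      rw [(edist_assign_clause h2 hv).2 ⟨q, hq, (hbx g).symm ▸ hm', Or.inl hve⟩]

/-- Take the even copy of each forced pair and of the chosen assignment of each bucket. Vertices
with different bits are resolved by adjacency to a forced vertex; `bit_sep` leaves only the pairs.
-/
theorem exists_isResolvingSet_of_choice [Fintype V]
    (hmeets : ∀ g < buckets, ∀ l < assignments, ∃ p < portals, meets p g l)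
    (L : ℕ → ℕ) (hL : ∀ g < buckets, L g < assignments)
    (hsat : ∀ r < clauses, ∃ g < buckets, ∀ p < portals, meets p g (L g) → removed r p) :
    ∃ S : Finset V, S.card ≤ labels.card + buckets ∧
      (Y.graph meets removed).IsResolvingSet (S : Set V) := by
  classical
  let S₀ : Finset V := Finset.univ.filter fun u => Y.tag u = 0 ∧ Y.e u = false
  let S₁ : Finset V := Finset.univ.filter fun u => Y.tag u = 2 ∧ Y.e u = false ∧ Y.y u = L (Y.x u)
  refine ⟨S₀ ∪ S₁, ?_, ?_⟩
  · refine (Finset.card_union_le _ _).trans (Nat.add_le_add ?_ ?_)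
    · refine Finset.card_le_card_of_injOn Y.x ?_ ?_
      · intro u hu
        simp only [S₀, Finset.coe_filter, Finset.mem_univ, true_and, Set.mem_ofPred_eq] at hu
        exact Y.forced_mem u hu.1
      · intro u hu v hv h
        simp only [S₀, Finset.coe_filter, Finset.mem_univ, true_and, Set.mem_ofPred_eq] at hu hv
        refine Y.inj u v (by omega) (by omega) h ?_ (hu.2.trans hv.2.symm)
        rw [Y.y_eq u (by omega), Y.y_eq v (by omega)]
    · rw [← Finset.card_range buckets]
      refine Finset.card_le_card_of_injOn Y.x ?_ ?_
      · intro u hu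
        simp only [S₁, Finset.coe_filter, Finset.mem_univ, true_and, Set.mem_ofPred_eq] at hu
        simpa using (Y.assign_lt u hu.1).1
      · intro u hu v hv h
        simp only [S₁, Finset.coe_filter, Finset.mem_univ, true_and, Set.mem_ofPred_eq] at hu hv
        refine Y.inj u v (by omega) (by omega) h ?_ (hu.2.1.trans hv.2.1.symm)
        rw [hu.2.2, hv.2.2, h]
  · have memS : ∀ w, w ∈ ((S₀ ∪ S₁ : Finset V) : Set V) ↔ (Y.tag w = 0 ∧ Y.e w = false) ∨
        (Y.tag w = 2 ∧ Y.e w = false ∧ Y.y w = L (Y.x w)) := by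
      intro w; simp [S₀, S₁]
    intro u v huv
    by_cases hu : u ∈ ((S₀ ∪ S₁ : Finset V) : Set V)
    · exact ⟨u, hu, by simpa using (SimpleGraph.edist_pos_of_ne huv).ne⟩
    by_cases hv : v ∈ ((S₀ ∪ S₁ : Finset V) : Set V)
    · exact ⟨v, hv, by simpa using huv.symm⟩
    by_cases hbits : ∀ a ∈ labels, (Y.bit u a ↔ Y.bit v a)
    · obtain ⟨he, ht, hx, htag⟩ := (Y.bit_sep u v hbits).resolve_left huv
      clear hbits
      wlog hue : Y.e u = false generalizing u v
      · obtain ⟨w, hw, hne⟩ := this v u huv.symm hv hu he.symm ht.symm hx.symm (ht ▸ htag)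
          (by revert he hue; cases Y.e u <;> cases Y.e v <;> simp)
        exact ⟨w, hw, hne.symm⟩
      have hve : Y.e v = true := by revert he hue; cases Y.e u <;> cases Y.e v <;> simp
      rcases htag with h | h | h
      · exact absurd ((memS u).2 (Or.inl ⟨h, hue⟩)) hu
      · obtain ⟨g, hg, hp⟩ := hsat _ (Y.clause_lt u h)
        obtain ⟨w, hw, hwx, hwy, hwe⟩ := Y.assign_exists g hg _ (hL g hg)
        refine ⟨w, (memS w).2 (Or.inr ⟨hw, hwe, by rw [hwy, hwx]⟩), ?_⟩
        obtain ⟨q, hq, hm⟩ := hmeets g hg _ (hL g hg)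
        rw [(edist_assign_clause hw (ht ▸ h)).2 ⟨q, hq, by rw [hwx, hwy]; exact hm, Or.inl hve⟩]
        rw [ne_eq, edist_assign_clause hw h]
        rintro ⟨p, hp', hm', h'⟩
        rw [hwx, hwy] at hm'
        simp [hue, hp p hp' hm'] at h'
      · have hg := Y.bucket_lt u h
        obtain ⟨w, hw, hwx, hwy, hwe⟩ := Y.assign_exists _ hg _ (hL _ hg)
        refine ⟨w, (memS w).2 (Or.inr ⟨hw, hwe, by rw [hwy, hwx]⟩), ?_⟩
        rw [SimpleGraph.edist_eq_one_iff_adj.2 ((adj_bucket_assign h hw).2 ⟨hue, hwx.symm⟩).symm]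
        intro h1
        have := (adj_bucket_assign (ht ▸ h) hw).1 (SimpleGraph.edist_eq_one_iff_adj.1 h1.symm).symm
        simp [hve] at this
    · push Not at hbits
      obtain ⟨a, ha, hab⟩ := hbits
      obtain ⟨w, hw, hwa, hwe⟩ := Y.forced_exists a ha false
      have hwS := (memS w).2 (Or.inl ⟨hw, hwe⟩)
      refine ⟨w, hwS, fun heq => ?_⟩
      have hwu : w ≠ u := by rintro rfl; exact hu hwS
      have hwv : w ≠ v := by rintro rfl; exact hv hwS
      have h1 := adj_of_forced (meets := meets) (removed := removed) hw hwu
      have h2 := adj_of_forced (meets := meets) (removed := removed) hw hwv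
      rw [← SimpleGraph.edist_eq_one_iff_adj, hwa] at h1 h2
      rw [heq, h2] at h1
      tauto

/-- Every line of `Rel` starts at a vertex of tag `0`, `1`, `4` or `5`. The factor `2` allows for
both copies. -/
theorem vertexCoverNum_graph_le [Fintype V] :
    (Y.graph meets removed).vertexCoverNum ≤
      ((2 * (labels.card + portals + buckets + 1) : ℕ) : ℕ∞) := by
  classical
  let c : Finset V := Finset.univ.filter fun u =>
    Y.tag u = 0 ∨ Y.tag u = 1 ∨ Y.tag u = 4 ∨ Y.tag u = 5
  have hc : (Y.graph meets removed).IsVertexCover (c : Set V) := by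
    rintro u v ⟨-, h⟩
    simp only [Rel] at h
    simp only [c, Finset.coe_filter, Finset.mem_univ, true_and, Set.mem_ofPred_eq]
    tauto
  refine hc.vertexCoverNum_le.trans ?_
  rw [Set.encard_coe_eq_coe_finsetCard]
  norm_cast
  let T : Finset ((ℕ × ℕ) × Bool) :=
    (({0} ×ˢ labels) ∪ ({1} ×ˢ Finset.range portals) ∪ ({4} ×ˢ Finset.range buckets) ∪
      {(5, 0)}) ×ˢ Finset.univ
  have hT : T.card ≤ 2 * (labels.card + portals + buckets + 1) := by
    rw [Finset.card_product, Finset.card_univ, Fintype.card_bool, mul_comm]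
    refine Nat.mul_le_mul_left 2 ?_
    refine (Finset.card_union_le _ _).trans (Nat.add_le_add ?_ (by simp))
    refine (Finset.card_union_le _ _).trans (Nat.add_le_add ?_ (by simp))
    refine (Finset.card_union_le _ _).trans (Nat.add_le_add ?_ ?_) <;> simp
  refine le_trans (Finset.card_le_card_of_injOn (fun u => ((Y.tag u, Y.x u), Y.e u)) ?_ ?_) hT
  · intro u hu
    simp only [c, Finset.coe_filter, Finset.mem_univ, true_and, Set.mem_ofPred_eq] at hu
    have h1 := Y.forced_mem u
    have h2 := Y.portal_lt u
    have h3 := Y.bucket_lt u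
    have h4 := Y.hub_eq u
    rcases hu with h | h | h | h <;> simp [T, h] at * <;>
      first | assumption | (cases Y.e u <;> simp [h4])
  · intro u hu v hv h
    simp only [c, Finset.coe_filter, Finset.mem_univ, true_and, Set.mem_ofPred_eq] at hu hv
    simp only [Prod.mk.injEq] at h
    refine Y.inj u v h.1.1 (by omega) h.1.2 ?_ h.2
    rw [Y.y_eq u (by omega), Y.y_eq v (by omega)]

end Layout

namespace MetricReduction

/-! ### Numbering of the vertices -/

/-- A vertex number is a copy bit followed by a five-digit number in this base. The exponent makes a
digit large enough to index all clauses; see `length_clauses_le`. -/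
def base (b : ℕ) : ℕ := 2 ^ (15 * b)

def order (b : ℕ) : ℕ := 2 * base b ^ 5

/-- The second alternative says that `u / 2` is a power of two, in a form that a machine can test.
-/
def IsForced (u : ℕ) : Prop := u / 2 = 0 ∨ 2 ^ Nat.clog 2 (u / 2) = u / 2

def IsPortal (b u : ℕ) : Prop := u / 2 / base b = 6 ∧ u / 2 % base b < 9 * b

/-- The two lowest digits vanish, which keeps the bits disjoint from those of clauses. Here and for
portals, clauses and buckets, the leading digit is `3`, `5` or `6`, hence not a power of two, so
none of them is forced. -/
def IsAssign (b u : ℕ) : Prop :=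
  u / 2 % (base b * base b) = 0 ∧ u / 2 / (base b * base b) / base b / base b = 3 ∧
    u / 2 / (base b * base b) / base b % base b < 3 * b ∧
    u / 2 / (base b * base b) % base b < 2 ^ b

def IsClause (b m u : ℕ) : Prop := u / 2 / base b = 3 ∧ u / 2 % base b < m

def IsBucket (b u : ℕ) : Prop := u / 2 / base b = 5 ∧ u / 2 % base b < 3 * b

def IsHub (b u : ℕ) : Prop := u + 1 = order b

open Classical in
noncomputable def tag (b m u : ℕ) : ℕ :=
  if IsForced u then 0 else if IsPortal b u then 1 else if IsAssign b u then 2 else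
    if IsClause b m u then 3 else if IsBucket b u then 4 else if IsHub b u then 5 else 6

open Classical in
noncomputable def par (b m u : ℕ) : ℕ :=
  if tag b m u = 0 then u / 2 else if tag b m u = 2 then u / 2 / (base b * base b) / base b % base b
    else if tag b m u = 5 then 0 else u / 2 % base b

open Classical in
noncomputable def par' (b m u : ℕ) : ℕ :=
  if tag b m u = 2 then u / 2 / (base b * base b) % base b else 0

/-- Label `2 ^ i` reads binary digit `i` of `v / 2`. Label `0` reads the copy bit, except on the
kinds whose two copies must stay indistinguishable. -/
def bit (b m v a : ℕ) : Prop :=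
  (a = 0 ∧ (v / 2 = 0 ∨ (v % 2 = 1 ∧ tag b m v ≠ 0 ∧ tag b m v ≠ 3 ∧ tag b m v ≠ 4))) ∨
    (a ≠ 0 ∧ v / 2 / a % 2 = 1)

/-- Rounding gives label `0` for `j = 0`. -/
def labels (b : ℕ) : Finset ℕ := (Finset.range (75 * b + 1)).image fun j => 2 ^ j / 2

theorem mem_labels {b a : ℕ} : a ∈ labels b ↔ a = 0 ∨ ∃ i < 75 * b, a = 2 ^ i := by
  simp only [labels, Finset.mem_image, Finset.mem_range]
  constructor
  · rintro ⟨j, hj, rfl⟩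
    rcases j with _ | i
    · simp
    · exact Or.inr ⟨i, by omega, by rw [pow_succ]; simp⟩
  · rintro (rfl | ⟨i, hi, rfl⟩)
    · exact ⟨0, by omega, by simp⟩
    · exact ⟨i + 1, by omega, by rw [pow_succ]; simp⟩

theorem card_labels (b : ℕ) : (labels b).card = 75 * b + 1 := by
  rw [labels, Finset.card_image_of_injective, Finset.card_range]
  intro i j h
  rcases i with _ | i <;> rcases j with _ | j <;> simp only [pow_succ] at h
  · rfl
  · have := Nat.two_pow_pos j; simp at h; omega
  · have := Nat.two_pow_pos i; simp at h
  · simp at h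
    simpa using h

section

variable {b m u v : ℕ}

theorem base_pos : 0 < base b := Nat.two_pow_pos _

theorem mul_two_pow_le_base (hb : 1 ≤ b) : 16 * 2 ^ b ≤ base b := by
  rw [base, show 16 = 2 ^ 4 by norm_num, ← pow_add]
  exact Nat.pow_le_pow_right (by norm_num) (by omega)

theorem base_bounds (hb : 1 ≤ b) : 9 * b < base b ∧ 2 ^ b < base b ∧ 32 ≤ base b := by
  have h1 := mul_two_pow_le_base hb
  have h2 : b < 2 ^ b := Nat.lt_two_pow_self
  omega

theorem base_pow_five : base b ^ 5 = 2 ^ (75 * b) := by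
  rw [base, ← pow_mul]; ring_nf

theorem two_pow_div_two_pow (i k : ℕ) : 2 ^ i / 2 ^ k = 0 ∨ ∃ j, 2 ^ i / 2 ^ k = 2 ^ j := by
  by_cases h : k ≤ i
  · exact Or.inr ⟨i - k, Nat.pow_div h (by norm_num)⟩
  · exact Or.inl (Nat.div_eq_of_lt (Nat.pow_lt_pow_right (by norm_num) (by omega)))

theorem two_pow_ne (j : ℕ) : 2 ^ j ≠ 3 ∧ 2 ^ j ≠ 5 ∧ 2 ^ j ≠ 6 := by
  rcases j with _ | _ | _ | j
  · norm_num
  · norm_num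
  · norm_num
  · have : 2 ^ (j + 1 + 1 + 1) = 8 * 2 ^ j := by ring
    have := Nat.two_pow_pos j
    omega

theorem IsForced.eq_two_pow (h : IsForced u) : u / 2 = 0 ∨ ∃ i, u / 2 = 2 ^ i :=
  h.imp id fun h => ⟨_, h.symm⟩

theorem isForced_of_eq (h : u / 2 = 0 ∨ ∃ i, u / 2 = 2 ^ i) : IsForced u := by
  rcases h with h | ⟨i, h⟩
  · exact Or.inl h
  · exact Or.inr (by rw [h, Nat.clog_pow _ _ (by norm_num)])

theorem IsForced.div_two_pow_ne (h : IsForced u) (k : ℕ) :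
    u / 2 / 2 ^ k ≠ 3 ∧ u / 2 / 2 ^ k ≠ 5 ∧ u / 2 / 2 ^ k ≠ 6 := by
  rcases h.eq_two_pow with h | ⟨i, h⟩
  · simp [h]
  · rw [h]
    rcases two_pow_div_two_pow i k with h | ⟨j, h⟩
    · simp [h]
    · rw [h]; exact two_pow_ne j

theorem IsAssign.div (h : IsAssign b u) : u / 2 / 2 ^ (60 * b) = 3 := by
  have : base b * base b * base b * base b = 2 ^ (60 * b) := by
    rw [base, ← pow_add, ← pow_add, ← pow_add]
    ring_nf
  rw [← h.2.1, Nat.div_div_eq_div_mul _ (_ * _), Nat.div_div_eq_div_mul _ (_ * _ * _), this]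

theorem IsAssign.div_base (hb : 1 ≤ b) (h : IsAssign b u) : 6 < u / 2 / base b := by
  obtain ⟨h1, h2, -⟩ := h
  obtain ⟨y, hy⟩ := Nat.dvd_of_mod_eq_zero h1
  have hP := base_bounds hb
  rw [hy, Nat.mul_div_cancel_left _ (Nat.mul_pos base_pos base_pos)] at h2
  rw [hy, mul_assoc, Nat.mul_div_cancel_left _ base_pos]
  have : 0 < y := by
    rcases Nat.eq_zero_or_pos y with h | h
    · simp [h] at h2
    · exact h
  nlinarith

theorem IsHub.half (h : IsHub b u) : u / 2 = base b ^ 5 - 1 ∧ u % 2 = 1 := by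
  have : 0 < base b ^ 5 := Nat.pow_pos base_pos
  rw [IsHub, order] at h
  omega

theorem IsHub.not_forced (hb : 1 ≤ b) (h : IsHub b u) : ¬ IsForced u := by
  intro h'
  have h1 := h.half.1
  rw [base_pow_five] at h1
  obtain ⟨k, hk⟩ : ∃ k, 75 * b = k + 2 := ⟨75 * b - 2, by omega⟩
  rw [hk, pow_add] at h1
  have := Nat.two_pow_pos k
  rcases h'.eq_two_pow with h2 | ⟨i, h2⟩
  · omega
  · rcases i with _ | i
    · omega
    · rw [pow_succ] at h2
      omega

theorem IsHub.div_base (hb : 1 ≤ b) (h : IsHub b u) : 6 < u / 2 / base b := by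
  have hP := base_bounds hb
  rw [h.half.1]
  refine lt_of_lt_of_le (by omega : 6 < base b) ?_
  rw [Nat.le_div_iff_mul_le base_pos]
  have : base b * base b * 32 ≤ base b * base b * base b ^ 3 :=
    Nat.mul_le_mul_left _ (hP.2.2.trans (Nat.le_self_pow (by norm_num) _))
  have h5 : base b * base b * base b ^ 3 = base b ^ 5 := by ring
  have : 0 < base b * base b := Nat.mul_pos base_pos base_pos
  omega

theorem IsHub.not_assign (hb : 1 ≤ b) (h : IsHub b u) : ¬ IsAssign b u := by
  intro h'
  have h1 := h.half.1
  have h2 := Nat.dvd_of_mod_eq_zero h'.1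
  have h3 : base b * base b ∣ base b ^ 5 := ⟨base b ^ 3, by ring⟩
  have h4 : 0 < base b ^ 5 := Nat.pow_pos base_pos
  rw [h1] at h2
  have h5 := (Nat.dvd_sub h3 h2)
  have hP := base_bounds hb
  rw [show base b ^ 5 - (base b ^ 5 - 1) = 1 by omega, Nat.dvd_one] at h5
  nlinarith

theorem tag_eq_zero : tag b m u = 0 ↔ IsForced u := by
  unfold tag
  split_ifs <;> simp_all

theorem tag_eq_one : tag b m u = 1 ↔ IsPortal b u := by
  have := IsForced.div_two_pow_ne (u := u)
  unfold tag
  split_ifs with h0 <;> simp_all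
  intro h
  exact (this (15 * b)).2.2 h.1

theorem tag_eq_two (hb : 1 ≤ b) : tag b m u = 2 ↔ IsAssign b u := by
  have h1 : IsForced u → ¬ IsAssign b u := fun h h' => (h.div_two_pow_ne _).1 h'.div
  have h2 : IsPortal b u → ¬ IsAssign b u := fun h h' => by
    have := h'.div_base hb; have := h.1; omega
  unfold tag
  split_ifs <;> simp_all

theorem tag_eq_three (hb : 1 ≤ b) : tag b m u = 3 ↔ IsClause b m u := by
  have h1 : IsForced u → ¬ IsClause b m u := fun h h' => (h.div_two_pow_ne (15 * b)).1 h'.1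
  have h2 : IsPortal b u → ¬ IsClause b m u := fun h h' => by have := h.1; have := h'.1; omega
  have h3 : IsAssign b u → ¬ IsClause b m u := fun h h' => by
    have := h.div_base hb; have := h'.1; omega
  unfold tag
  split_ifs <;> simp_all

theorem tag_eq_four (hb : 1 ≤ b) : tag b m u = 4 ↔ IsBucket b u := by
  have h1 : IsForced u → ¬ IsBucket b u := fun h h' => (h.div_two_pow_ne (15 * b)).2.1 h'.1
  have h2 : IsPortal b u → ¬ IsBucket b u := fun h h' => by have := h.1; have := h'.1; omega
  have h3 : IsAssign b u → ¬ IsBucket b u := fun h h' => by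
    have := h.div_base hb; have := h'.1; omega
  have h4 : IsClause b m u → ¬ IsBucket b u := fun h h' => by have := h.1; have := h'.1; omega
  unfold tag
  split_ifs <;> simp_all

theorem tag_eq_five (hb : 1 ≤ b) : tag b m u = 5 ↔ IsHub b u := by
  have h1 : IsForced u → ¬ IsHub b u := fun h h' => h'.not_forced hb h
  have h2 : IsPortal b u → ¬ IsHub b u := fun h h' => by
    have := h.1; have := h'.div_base hb; omega
  have h3 : IsAssign b u → ¬ IsHub b u := fun h h' => h'.not_assign hb h
  have h4 : IsClause b m u → ¬ IsHub b u := fun h h' => by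
    have := h.1; have := h'.div_base hb; omega
  have h5 : IsBucket b u → ¬ IsHub b u := fun h h' => by
    have := h.1; have := h'.div_base hb; omega
  unfold tag
  split_ifs <;> simp_all

theorem bit_zero : bit b m v 0 ↔
    (v / 2 = 0 ∨ (v % 2 = 1 ∧ tag b m v ≠ 0 ∧ tag b m v ≠ 3 ∧ tag b m v ≠ 4)) := by
  simp [bit]

theorem bit_two_pow (i : ℕ) : bit b m v (2 ^ i) ↔ (v / 2).testBit i = true := by
  simp [bit, Nat.testBit_eq_decide_div_mod_eq]

theorem half_lt (hu : u < order b) : u / 2 < 2 ^ (75 * b) := by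
  rw [order, base_pow_five] at hu
  omega

theorem half_eq_of_testBit (hu : u < order b) (hv : v < order b)
    (h : ∀ i < 75 * b, (u / 2).testBit i = (v / 2).testBit i) : u / 2 = v / 2 := by
  apply Nat.eq_of_testBit_eq
  intro i
  by_cases hi : i < 75 * b
  · exact h i hi
  · have hle : 2 ^ (75 * b) ≤ 2 ^ i := Nat.pow_le_pow_right (by norm_num) (by omega)
    rw [Nat.testBit_eq_false_of_lt ((half_lt hu).trans_le hle),
      Nat.testBit_eq_false_of_lt ((half_lt hv).trans_le hle)]

theorem half_eq (hb : 1 ≤ b) (ht : tag b m u = tag b m v) (h6 : tag b m u ≠ 6)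
    (hx : par b m u = par b m v) (hy : par' b m u = par' b m v) : u / 2 = v / 2 := by
  have hle : tag b m u ≤ 6 := by unfold tag; split_ifs <;> simp
  have combine : ∀ {c d q : ℕ}, c / q = d / q → c % q = d % q → c = d := fun {c d q} h1 h2 => by
    rw [← Nat.div_add_mod c q, h1, h2, Nat.div_add_mod]
  obtain h | h | h | h | h | h : tag b m u = 0 ∨ tag b m u = 1 ∨ tag b m u = 2 ∨ tag b m u = 3 ∨
    tag b m u = 4 ∨ tag b m u = 5 := by omega
  all_goals
    have h' := h
    rw [ht] at h'
    simp only [par, par', h, h'] at hx hy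
    norm_num at hx hy
  · exact hx
  · rw [tag_eq_one] at h h'
    exact combine (h.1.trans h'.1.symm) hx
  · rw [tag_eq_two hb] at h h'
    exact combine (combine (combine (h.2.1.trans h'.2.1.symm) hx) hy) (h.1.trans h'.1.symm)
  · rw [tag_eq_three hb] at h h'
    exact combine (h.1.trans h'.1.symm) hx
  · rw [tag_eq_four hb] at h h'
    exact combine (h.1.trans h'.1.symm) hx
  · rw [tag_eq_five hb] at h h'
    unfold IsHub at h h'
    omega

theorem tag_eq_of_half_eq (hb : 1 ≤ b) (h : u / 2 = v / 2)
    (ht : tag b m u = 0 ∨ tag b m u = 3 ∨ tag b m u = 4) : tag b m u = tag b m v := by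
  rcases ht with ht | ht | ht
  · rw [ht, eq_comm]
    rw [tag_eq_zero] at *
    simpa [IsForced, h] using ht
  · rw [ht, eq_comm]
    rw [tag_eq_three hb] at *
    simpa [IsClause, h] using ht
  · rw [ht, eq_comm]
    rw [tag_eq_four hb] at *
    simpa [IsBucket, h] using ht

theorem bit_pair (hb : 1 ≤ b) (ht : tag b m u = tag b m v) (hx : par b m u = par b m v)
    (h : tag b m u = 3 ∨ tag b m u = 4) (a : ℕ) : bit b m u a ↔ bit b m v a := by
  have := half_eq hb ht (by omega) hx (by simp [par', show tag b m u ≠ 2 by omega,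
    show tag b m v ≠ 2 by omega])
  have h' : tag b m v = 3 ∨ tag b m v = 4 := by omega
  unfold bit
  rw [this]
  have h1 : ¬ (tag b m u ≠ 0 ∧ tag b m u ≠ 3 ∧ tag b m u ≠ 4) := by omega
  have h2 : ¬ (tag b m v ≠ 0 ∧ tag b m v ≠ 3 ∧ tag b m v ≠ 4) := by omega
  simp only [h1, h2, and_false]

theorem bit_forced (hu : tag b m u = 0) {a : ℕ} (ha : a ∈ labels b) :
    bit b m u a ↔ a = par b m u := by
  have hp : par b m u = u / 2 := by simp [par, hu]
  rw [hp]
  have hF := (tag_eq_zero.1 hu).eq_two_pow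
  rcases mem_labels.1 ha with rfl | ⟨i, -, rfl⟩
  · rw [bit_zero]
    simp only [hu]
    constructor
    · rintro (h | h)
      · exact h.symm
      · exact absurd rfl h.2.1
    · intro h
      exact Or.inl h.symm
  · rw [bit_two_pow]
    rcases hF with h | ⟨k, h⟩
    · simp [h]
    · rw [h, Nat.testBit_two_pow]
      simp only [decide_eq_true_eq]
      constructor
      · rintro rfl; rfl
      · intro h; exact (Nat.pow_right_injective (le_refl 2) h).symm

/-- Half of an assignment number is divisible by `2 ^ (30 * b)`, half of a clause number is smaller
than that. -/
theorem bit_disjoint (hb : 1 ≤ b) (hu : tag b m u = 2) (hv : tag b m v = 3) {a : ℕ}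
    (ha : a ∈ labels b) (h : bit b m u a) : ¬ bit b m v a := by
  have hu' := (tag_eq_two hb).1 hu
  have hv' := (tag_eq_three hb).1 hv
  have hP := base_bounds hb
  rcases mem_labels.1 ha with rfl | ⟨i, -, rfl⟩
  · rw [bit_zero]
    simp only [hv]
    rintro (h' | h')
    · simp [IsClause, h'] at hv'
    · exact h'.2.2.1 rfl
  · rw [bit_two_pow] at *
    intro h'
    obtain ⟨y, hy⟩ := Nat.dvd_of_mod_eq_zero hu'.1
    have hvlt : v / 2 < 2 ^ (30 * b) := by
      have h1 := Nat.div_add_mod (v / 2) (base b)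
      rw [hv'.1] at h1
      have h2 := Nat.mod_lt (v / 2) (base_pos (b := b))
      have h3 : 2 ^ (30 * b) = base b * base b := by rw [base, ← pow_add]; ring_nf
      rw [h3]
      nlinarith
    by_cases hi : i < 30 * b
    · rw [hy, base, ← pow_add, show 15 * b + 15 * b = 30 * b by ring, Nat.testBit_two_pow_mul] at h
      simp at h
      omega
    · rw [Nat.testBit_eq_false_of_lt] at h'
      · simp at h'
      · exact hvlt.trans_le (Nat.pow_le_pow_right (by norm_num) (by omega))

theorem bit_assign (hb : 1 ≤ b) (hlt : u < order b) (hu : tag b m u = 2) :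
    ∃ a ∈ labels b, bit b m u a := by
  have hu' := (tag_eq_two hb).1 hu
  have h0 : u / 2 ≠ 0 := by
    intro h
    simp [IsAssign, h] at hu'
  obtain ⟨i, hi⟩ := Nat.exists_testBit_of_ne_zero h0
  refine ⟨2 ^ i, mem_labels.2 (Or.inr ⟨i, ?_, rfl⟩), (bit_two_pow i).2 hi⟩
  by_contra hc
  rw [Nat.testBit_eq_false_of_lt] at hi
  · simp at hi
  · exact (half_lt hlt).trans_le (Nat.pow_le_pow_right (by norm_num) (by omega))

theorem bit_hub (hb : 1 ≤ b) (hu : tag b m u = 5) {a : ℕ} (ha : a ∈ labels b) : bit b m u a := by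
  have hu' := ((tag_eq_five hb).1 hu).half
  rcases mem_labels.1 ha with rfl | ⟨i, hi, rfl⟩
  · rw [bit_zero, hu]
    exact Or.inr ⟨hu'.2, by norm_num⟩
  · rw [bit_two_pow, hu'.1, base_pow_five, Nat.testBit_two_pow_sub_one]
    simpa using hi

theorem bit_sep (hb : 1 ≤ b) (hu : u < order b) (hv : v < order b)
    (h : ∀ a ∈ labels b, (bit b m u a ↔ bit b m v a)) : u = v ∨
      (decide (u % 2 = 1) ≠ decide (v % 2 = 1) ∧ tag b m u = tag b m v ∧ par b m u = par b m v ∧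
        (tag b m u = 0 ∨ tag b m u = 3 ∨ tag b m u = 4)) := by
  have hx : u / 2 = v / 2 := by
    refine half_eq_of_testBit hu hv fun i hi => ?_
    have := h _ (mem_labels.2 (Or.inr ⟨i, hi, rfl⟩))
    rw [bit_two_pow, bit_two_pow] at this
    exact Bool.eq_iff_iff.2 this
  by_cases he : u % 2 = v % 2
  · left; omega
  right
  refine ⟨fun hd => ?_, ?_⟩
  · simp only [decide_eq_decide] at hd
    omega
  have finish : (tag b m u = 0 ∨ tag b m u = 3 ∨ tag b m u = 4) →
      tag b m u = tag b m v ∧ par b m u = par b m v ∧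
        (tag b m u = 0 ∨ tag b m u = 3 ∨ tag b m u = 4) := by
    intro ht
    have htt := tag_eq_of_half_eq hb hx ht
    refine ⟨htt, ?_, ht⟩
    unfold par
    rw [htt, hx]
  by_cases ht : tag b m u = 0 ∨ tag b m u = 3 ∨ tag b m u = 4
  · exact finish ht
  by_cases ht' : tag b m v = 0 ∨ tag b m v = 3 ∨ tag b m v = 4
  · have := tag_eq_of_half_eq hb hx.symm ht'
    exact finish (this ▸ ht')
  exfalso
  have h0 := h 0 (mem_labels.2 (Or.inl rfl))
  rw [bit_zero, bit_zero] at h0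
  have hx0 : u / 2 ≠ 0 := by
    intro hx0
    exact ht (Or.inl (tag_eq_zero.2 (Or.inl hx0)))
  omega

theorem lt_order {c : ℕ} (hx : u < 32 * base b) (hb : 1 ≤ b) (hc : c ≤ 1) :
    2 * u + c < order b := by
  have hP := base_bounds hb
  have : base b * 32 ≤ base b * base b ^ 4 :=
    Nat.mul_le_mul_left _ (hP.2.2.trans (Nat.le_self_pow (by norm_num) _))
  have h5 : base b * base b ^ 4 = base b ^ 5 := by ring
  rw [order]
  omega

theorem exists_low (hb : 1 ≤ b) {t r : ℕ} (ht : t < 16) (hr : r < base b) (c : Bool) :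
    ∃ u, u < order b ∧ u / 2 / base b = t ∧ u / 2 % base b = r ∧ decide (u % 2 = 1) = c := by
  have h1 : t * base b ≤ 15 * base b := Nat.mul_le_mul_right _ (by omega)
  refine ⟨2 * (r + base b * t) + c.toNat, lt_order ?_ hb (by cases c <;> simp), ?_, ?_, ?_⟩
  · rw [mul_comm (base b)]; omega
  · rw [show (2 * (r + base b * t) + c.toNat) / 2 = r + base b * t by cases c <;> simp; omega,
      Nat.add_mul_div_left _ _ base_pos, Nat.div_eq_of_lt hr, zero_add]
  · rw [show (2 * (r + base b * t) + c.toNat) / 2 = r + base b * t by cases c <;> simp; omega,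
      Nat.add_mul_mod_self_left, Nat.mod_eq_of_lt hr]
  · cases c <;> simp

theorem exists_assign (hb : 1 ≤ b) {g l : ℕ} (hg : g < 3 * b) (hl : l < 2 ^ b) :
    ∃ u, u < order b ∧ tag b m u = 2 ∧ par b m u = g ∧ par' b m u = l ∧
      decide (u % 2 = 1) = false := by
  have hP := base_bounds hb
  set P := base b with hPdef
  have h0 : 0 < P := base_pos
  have hx : (2 * (P * P * (l + P * (g + P * 3)))) / 2 = P * P * (l + P * (g + P * 3)) := by
    omega
  have hy : (2 * (P * P * (l + P * (g + P * 3)))) / 2 / (P * P) = l + P * (g + P * 3) := by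
    rw [hx, Nat.mul_div_cancel_left _ (Nat.mul_pos h0 h0)]
  have hy1 : (l + P * (g + P * 3)) / P = g + P * 3 := by
    rw [Nat.add_mul_div_left _ _ h0, Nat.div_eq_of_lt (by omega), zero_add]
  have hy2 : (l + P * (g + P * 3)) % P = l := by
    rw [Nat.add_mul_mod_self_left, Nat.mod_eq_of_lt (by omega)]
  have hy3 : (g + P * 3) / P = 3 := by
    rw [Nat.add_mul_div_left _ _ h0, Nat.div_eq_of_lt (by omega), zero_add]
  have hy4 : (g + P * 3) % P = g := by
    rw [Nat.add_mul_mod_self_left, Nat.mod_eq_of_lt (by omega)]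
  have ht : tag b m (2 * (P * P * (l + P * (g + P * 3)))) = 2 := by
    rw [tag_eq_two hb, IsAssign, ← hPdef, hy, hy1, hy2, hy3, hy4, hx]
    exact ⟨Nat.mul_mod_right _ _, rfl, hg, hl⟩
  refine ⟨_, ?_, ht, ?_, ?_, by simp⟩
  · rw [order, ← hPdef]
    refine Nat.mul_lt_mul_of_pos_left ?_ (by norm_num)
    have h3 : l + P * (g + P * 3) < P * P * P := by
      have : P * (g + P * 3) ≤ P * (P + P * 3) := Nat.mul_le_mul_left _ (by omega)
      have : P * P * 32 ≤ P * P * P := Nat.mul_le_mul_left _ hP.2.2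
      nlinarith
    calc _ < P * P * (P * P * P) := Nat.mul_lt_mul_of_pos_left h3 (Nat.mul_pos h0 h0)
      _ = P ^ 5 := by ring
  · rw [par, ht, ← hPdef, hy, hy1, hy4]; simp
  · rw [par', ht, ← hPdef, hy, hy2]; simp

end

/-- The layout of the vertices of the metric dimension instance. -/
noncomputable def layout (b m : ℕ) (hb : 1 ≤ b) (hm : m ≤ base b) :
    Layout (Fin (order b)) (labels b) (3 * b) m (9 * b) (2 ^ b) where
  tag u := tag b m u
  x u := par b m u
  y u := par' b m u
  e u := decide ((u : ℕ) % 2 = 1)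
  bit u a := bit b m u a
  inj u v ht h6 hx hy he := by
    have := half_eq hb ht h6 hx hy
    rw [decide_eq_decide] at he
    apply Fin.ext
    omega
  y_eq u h := by simp [par', h]
  forced_mem u h := by
    have h1 := half_lt u.2
    simp only [par, h, if_true]
    rcases (tag_eq_zero.1 h).eq_two_pow with h | ⟨i, h⟩
    · exact mem_labels.2 (Or.inl h)
    · refine mem_labels.2 (Or.inr ⟨i, ?_, h⟩)
      rw [h] at h1
      exact (Nat.pow_lt_pow_iff_right (by norm_num)).1 h1
  portal_lt u h := by
    simp only [par, h]
    exact (tag_eq_one.1 h).2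
  assign_lt u h := by
    simp only [par, par', h]
    exact ((tag_eq_two hb).1 h).2.2
  clause_lt u h := by
    simp only [par, h]
    exact ((tag_eq_three hb).1 h).2
  bucket_lt u h := by
    simp only [par, h]
    exact ((tag_eq_four hb).1 h).2
  hub_eq u h := by simp [par, h]
  forced_exists a ha c := by
    have hlt : a < base b ^ 5 := by
      rw [base_pow_five]
      rcases mem_labels.1 ha with rfl | ⟨i, hi, rfl⟩
      · exact Nat.two_pow_pos _
      · exact Nat.pow_lt_pow_right (by norm_num) hi
    have hx : (2 * a + c.toNat) / 2 = a := by cases c <;> simp; omega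
    have ht : tag b m (2 * a + c.toNat) = 0 := by
      rw [tag_eq_zero]
      refine isForced_of_eq ?_
      rw [hx]
      exact (mem_labels.1 ha).imp id fun ⟨i, _, h⟩ => ⟨i, h⟩
    refine ⟨⟨2 * a + c.toNat, ?_⟩, ht, ?_, ?_⟩
    · rw [order]
      have : c.toNat ≤ 1 := Bool.toNat_le c
      omega
    · simp [par, ht, hx]
    · cases c <;> simp
  portal_exists p hp := by
    have hP := base_bounds hb
    obtain ⟨u, hu, h1, h2, -⟩ := exists_low hb (t := 6) (by norm_num)
      (show p < base b by omega) false
    have ht : tag b m u = 1 := tag_eq_one.2 ⟨h1, by omega⟩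
    exact ⟨⟨u, hu⟩, ht, by simp [par, ht, h2]⟩
  assign_exists g hg l hl := by
    obtain ⟨u, hu, h⟩ := exists_assign (m := m) hb hg hl
    exact ⟨⟨u, hu⟩, h⟩
  clause_exists r hr c := by
    obtain ⟨u, hu, h1, h2, h3⟩ := exists_low hb (t := 3) (by norm_num)
      (show r < base b by omega) c
    have ht : tag b m u = 3 := (tag_eq_three hb).2 ⟨h1, by omega⟩
    exact ⟨⟨u, hu⟩, ht, by simp [par, ht, h2], h3⟩
  bucket_exists g hg c := by
    have hP := base_bounds hb
    obtain ⟨u, hu, h1, h2, h3⟩ := exists_low hb (t := 5) (by norm_num)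
      (show g < base b by omega) c
    have ht : tag b m u = 4 := (tag_eq_four hb).2 ⟨h1, by omega⟩
    exact ⟨⟨u, hu⟩, ht, by simp [par, ht, h2], h3⟩
  hub_exists := by
    have : 0 < base b ^ 5 := Nat.pow_pos base_pos
    have h : order b - 1 < order b := by rw [order]; omega
    exact ⟨⟨order b - 1, h⟩, (tag_eq_five hb).2 (by simp only [IsHub]; omega)⟩
  bit_forced u h a ha := bit_forced h ha
  bit_pair u v ht hx h a _ := bit_pair hb ht hx h a
  bit_disjoint u v hu hv a ha h := bit_disjoint hb hu hv ha h
  bit_assign u h := bit_assign hb u.2 h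
  bit_hub u h a ha := bit_hub hb h ha
  bit_sep u v h := (bit_sep hb u.2 v.2 h).imp Fin.ext id

end MetricReduction

namespace MetricReduction

/-! ### Portals -/

/-- Portal `p` is adjacent to the assignment vertex of assignment `l` of bucket `g`. -/
def Meets (b p g l : ℕ) : Prop :=
  p / b / 3 = g / b ∧ ((p / b % 3 = 0 ∧ p % b = g % b) ∨
    (p / b % 3 = 1 ∧ l / 2 ^ (p % b) % 2 = 1) ∨ (p / b % 3 = 2 ∧ l / 2 ^ (p % b) % 2 = 0))

/-- The literal of the given part, index and sign suppresses the edge from a clause to portal `p`. -/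
def RemovedBy (b p part index sign : ℕ) : Prop :=
  p / b / 3 = part ∧ ((p / b % 3 = 0 ∧ p % b = index / b) ∨
    (p / b % 3 ≠ 0 ∧ ¬ (p % b = index % b ∧ p / b % 3 = 1 + sign)))

def Removed (ψ : PartitionedSAT) (b r p : ℕ) : Prop :=
  ∃ l ∈ ψ.clauses.getD r [], RemovedBy b p l.part l.index (if l.positive then 1 else 0)

section

variable {b : ℕ}

theorem portal_decode (hb : 1 ≤ b) {d t j : ℕ} (ht : t < 3) (hj : j < b) :
    ((d * 3 + t) * b + j) / b / 3 = d ∧ ((d * 3 + t) * b + j) / b % 3 = t ∧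
      ((d * 3 + t) * b + j) % b = j := by
  have h1 : ((d * 3 + t) * b + j) / b = d * 3 + t := by
    rw [Nat.mul_comm, Nat.mul_add_div (by omega), Nat.div_eq_of_lt hj, add_zero]
  have h2 : ((d * 3 + t) * b + j) % b = j := by
    rw [Nat.mul_add_mod', Nat.mod_eq_of_lt hj]
  rw [h1, h2]
  omega

theorem portal_lt {d t j : ℕ} (hd : d < 3) (ht : t < 3) (hj : j < b) :
    (d * 3 + t) * b + j < 9 * b := by
  have : (d * 3 + t) * b ≤ 8 * b := Nat.mul_le_mul_right _ (by omega)
  omega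

theorem bucket_decode (hb : 1 ≤ b) {g : ℕ} (hg : g < 3 * b) : g / b < 3 ∧ g % b < b :=
  ⟨(Nat.div_lt_iff_lt_mul hb).2 hg, Nat.mod_lt _ hb⟩

theorem exists_meets (hb : 1 ≤ b) : ∀ g < 3 * b, ∀ l < 2 ^ b, ∃ p < 9 * b, Meets b p g l := by
  intro g hg l _
  obtain ⟨h1, h2⟩ := bucket_decode hb hg
  obtain ⟨h3, h4, h5⟩ := portal_decode (d := g / b) (t := 0) hb (by norm_num) h2
  exact ⟨_, portal_lt h1 (t := 0) (by norm_num) h2, h3, Or.inl ⟨h4, h5⟩⟩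

/-- One literal must delete the bucket portal and some literal the portal recording the value at its
position. These may be different literals of the clause, but `one_per_part` gives them the same
variable. -/
theorem removed_of_meets_iff (ψ : PartitionedSAT) (hb : 1 ≤ b)
    {C : List (Literal ψ.n)} (hC : C ∈ ψ.clauses) {g l : ℕ} (hg : g < 3 * b) :
    (∀ p < 9 * b, Meets b p g l →
      ∃ t ∈ C, RemovedBy b p t.part t.index (if t.positive then 1 else 0)) ↔
    ∃ t ∈ C, (t.part : ℕ) = g / b ∧ (t.index : ℕ) / b = g % b ∧
      (l / 2 ^ ((t.index : ℕ) % b) % 2 = if t.positive then 1 else 0) := by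
  obtain ⟨hd, hi⟩ := bucket_decode hb hg
  constructor
  · intro h
    obtain ⟨h3, h4, h5⟩ := portal_decode (d := g / b) (t := 0) hb (by norm_num) hi
    obtain ⟨t, ht, hp, hr⟩ := h _ (portal_lt hd (t := 0) (by norm_num) hi)
      ⟨h3, Or.inl ⟨h4, h5⟩⟩
    rw [h3] at hp
    rw [h4, h5] at hr
    simp only [ne_eq, not_true_eq_false, false_and, or_false, true_and] at hr
    have hj : (t.index : ℕ) % b < b := Nat.mod_lt _ hb
    have hs : l / 2 ^ ((t.index : ℕ) % b) % 2 < 2 := Nat.mod_lt _ (by norm_num)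
    obtain ⟨s, hs'⟩ : ∃ s, s = l / 2 ^ ((t.index : ℕ) % b) % 2 := ⟨_, rfl⟩
    -- Portal type `2 - s` is the one met by assignments with value `s` at this position.
    obtain ⟨h6, h7, h8⟩ := portal_decode (d := g / b) (t := 2 - s) hb (by omega) hj
    obtain ⟨t', ht', hp', hr'⟩ := h _ (portal_lt hd (t := 2 - s) (by omega) hj) (by
      refine ⟨h6, Or.inr ?_⟩
      rw [h7, h8, ← hs']
      omega)
    rw [h6] at hp'
    rw [h7, h8] at hr'
    have hidx := ψ.one_per_part C hC t ht t' ht' (Fin.ext (hp.symm.trans hp'))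
    refine ⟨t', ht', hp'.symm, by rw [← hidx, hr], ?_⟩
    rw [← hidx] at hr'
    rw [← hidx, ← hs']
    split_ifs at hr' ⊢ <;> omega
  · rintro ⟨t, ht, hp, hi', hs⟩ p - ⟨hm, hm'⟩
    refine ⟨t, ht, hm.trans hp.symm, ?_⟩
    rcases hm' with ⟨h1, h2⟩ | ⟨h1, h2⟩ | ⟨h1, h2⟩
    · exact Or.inl ⟨h1, h2.trans hi'.symm⟩
    · refine Or.inr ⟨by omega, ?_⟩
      rintro ⟨h3, h4⟩
      rw [← h3] at hs
      split_ifs at hs h4 <;> omega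
    · refine Or.inr ⟨by omega, ?_⟩
      rintro ⟨h3, h4⟩
      rw [← h3] at hs
      split_ifs at hs h4 <;> omega

theorem satisfiable_iff (ψ : PartitionedSAT) (hb : 1 ≤ b) (hn : ψ.n ≤ b * b) :
    ψ.Satisfiable ↔ ∃ L : ℕ → ℕ, (∀ g < 3 * b, L g < 2 ^ b) ∧
      ∀ r < ψ.clauses.length, ∃ g < 3 * b, ∀ p < 9 * b, Meets b p g (L g) → Removed ψ b r p := by
  have index_lt : ∀ i : Fin ψ.n, (i : ℕ) / b < b := fun i =>
    (Nat.div_lt_iff_lt_mul hb).2 (i.2.trans_le hn)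
  have bool_iff : ∀ c d : Bool, ((c.toNat = if d then 1 else 0) ↔ c = d) := by decide
  constructor
  · rintro ⟨π, hπ⟩
    let val : ℕ → ℕ → Bool := fun d i =>
      if h : d < 3 ∧ i < ψ.n then π ⟨d, h.1⟩ ⟨i, h.2⟩ else false
    refine ⟨fun g => Nat.ofBits fun j : Fin b => val (g / b) (g % b * b + j),
      fun g _ => Nat.ofBits_lt_two_pow _, ?_⟩
    intro r hr
    have hC : ψ.clauses.getD r [] ∈ ψ.clauses := by
      rw [List.getD_eq_getElem _ _ hr]; exact List.getElem_mem hr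
    obtain ⟨t, ht, hπt⟩ := hπ _ hC
    have hi := index_lt t.index
    have hj : (t.index : ℕ) % b < b := Nat.mod_lt _ hb
    have hg : (t.part : ℕ) * b + (t.index : ℕ) / b < 3 * b := by
      have : (t.part : ℕ) * b ≤ 2 * b := Nat.mul_le_mul_right _ (by omega)
      omega
    have h1 : ((t.part : ℕ) * b + (t.index : ℕ) / b) / b = t.part := by
      rw [Nat.mul_comm, Nat.mul_add_div (by omega), Nat.div_eq_of_lt hi, add_zero]
    have h2 : ((t.part : ℕ) * b + (t.index : ℕ) / b) % b = (t.index : ℕ) / b := by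
      rw [Nat.mul_add_mod', Nat.mod_eq_of_lt hi]
    refine ⟨_, hg, ?_⟩
    refine (removed_of_meets_iff ψ hb hC hg).2 ⟨t, ht, h1.symm, h2.symm, ?_⟩
    beta_reduce
    rw [h1, h2, ← Nat.toNat_testBit, bool_iff, Nat.testBit_ofBits_lt _ _ hj, ← hπt]
    have h3 : (t.index : ℕ) / b * b + (t.index : ℕ) % b = t.index := Nat.div_add_mod' _ _
    simp [val, h3]
  · rintro ⟨L, -, h⟩
    refine ⟨fun d i => (L (d * b + i / b)).testBit (i % b), ?_⟩
    intro C hC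
    obtain ⟨r, hr, rfl⟩ := List.getElem_of_mem hC
    obtain ⟨g, hg, hp⟩ := h r hr
    have hD : ψ.clauses.getD r [] = ψ.clauses[r] := List.getD_eq_getElem _ _ hr
    simp only [Removed, hD] at hp
    obtain ⟨t, ht, h1, h2, h3⟩ := (removed_of_meets_iff ψ hb hC hg).1 hp
    refine ⟨t, ht, ?_⟩
    rw [← bool_iff, Nat.toNat_testBit, h1, h2, Nat.div_add_mod']
    exact h3

end

/-! ### The instance of Metric Dimension -/

/-- The number of buckets per part, and the number of variables per bucket. -/
def side (ψ : PartitionedSAT) : ℕ := 2 ^ Nat.clog 4 ψ.n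

theorem one_le_side (ψ : PartitionedSAT) : 1 ≤ side ψ := Nat.one_le_two_pow

theorem side_mul_side (ψ : PartitionedSAT) : side ψ * side ψ = 4 ^ Nat.clog 4 ψ.n := by
  rw [side, ← mul_pow]
  norm_num

theorem n_le_side (ψ : PartitionedSAT) : ψ.n ≤ side ψ * side ψ := by
  rw [side_mul_side]
  exact Nat.le_pow_clog (by norm_num) _

theorem side_le (ψ : PartitionedSAT) (hn : 1 ≤ ψ.n) : side ψ * side ψ ≤ 4 * ψ.n := by
  rw [side_mul_side]
  rcases hn.lt_or_eq with h | h
  · have h1 := Nat.pow_pred_clog_lt_self (b := 4) (by norm_num) h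
    have h2 := Nat.clog_pos (b := 4) (by norm_num) h
    obtain ⟨k, hk⟩ : ∃ k, Nat.clog 4 ψ.n = k + 1 := ⟨_, (Nat.succ_pred_eq_of_pos h2).symm⟩
    rw [hk] at h1 ⊢
    simp only [Nat.pred_eq_sub_one, Nat.add_sub_cancel] at h1
    rw [pow_succ]
    omega
  · simp [← h]

/-- A clause is a triple of optional literals, and `6 * n + 1 ≤ 2 ^ (5 * b)`; cubing gives the
exponent `15 * b`. -/
theorem length_clauses_le (ψ : PartitionedSAT) : ψ.clauses.length ≤ base (side ψ) := by
  let code : Literal ψ.n → Fin 3 × Fin ψ.n × Bool := fun l => (l.part, l.index, l.positive)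
  have hcode : Function.Injective code := by
    rintro ⟨a, b, c⟩ ⟨a', b', c'⟩ h
    simp only [code, Prod.mk.injEq] at h
    obtain ⟨rfl, rfl, rfl⟩ := h
    rfl
  let triple : List (Literal ψ.n) → (Fin 3 → Option (Fin 3 × Fin ψ.n × Bool)) :=
    fun C i => C[(i : ℕ)]?.map code
  have hinj : ∀ C ∈ ψ.clauses, ∀ D ∈ ψ.clauses, triple C = triple D → C = D := by
    intro C hC D hD h
    apply List.ext_getElem?
    intro i
    by_cases hi : i < 3
    · exact Option.map_injective hcode (congrFun h ⟨i, hi⟩)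
    · have h1 := ψ.length_le C hC
      have h2 := ψ.length_le D hD
      rw [List.getElem?_eq_none (by omega), List.getElem?_eq_none (by omega)]
  have h1 := (ψ.nodup.map_on hinj).length_le_card
  simp only [List.length_map, Fintype.card_pi, Fintype.card_option, Fintype.card_prod,
    Fintype.card_fin, Fintype.card_bool, Finset.prod_const, Finset.card_univ] at h1
  refine h1.trans ?_
  have hb : side ψ < 2 ^ side ψ := Nat.lt_two_pow_self
  have hb1 := one_le_side ψ
  have hn := n_le_side ψ
  have h2 : side ψ * side ψ ≤ 2 ^ side ψ * 2 ^ side ψ := Nat.mul_le_mul hb.le hb.le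
  have h3 : 3 * (ψ.n * 2) + 1 ≤ 2 ^ (5 * side ψ) := by
    have h4 : 2 ^ 3 ≤ 2 ^ (3 * side ψ) := Nat.pow_le_pow_right (by norm_num) (by omega)
    have h5 : 2 ^ (5 * side ψ) = 2 ^ (3 * side ψ) * (2 ^ side ψ * 2 ^ side ψ) := by
      rw [← pow_add, ← pow_add]; ring_nf
    have h6 : 2 ^ 3 * (2 ^ side ψ * 2 ^ side ψ) ≤ 2 ^ (5 * side ψ) := by
      rw [h5]; exact Nat.mul_le_mul_right _ h4
    have h7 : 1 ≤ 2 ^ side ψ * 2 ^ side ψ :=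
      Nat.mul_pos (Nat.two_pow_pos _) (Nat.two_pow_pos _)
    omega
  calc (3 * (ψ.n * 2) + 1) ^ 3 ≤ (2 ^ (5 * side ψ)) ^ 3 := Nat.pow_le_pow_left h3 3
    _ = base (side ψ) := by rw [base, ← pow_mul]; ring_nf

noncomputable def vertexLayout (ψ : PartitionedSAT) :=
  layout (side ψ) ψ.clauses.length (one_le_side ψ) (length_clauses_le ψ)

noncomputable def target (ψ : PartitionedSAT) : MetricDimensionInstance where
  numVerts := order (side ψ)
  graph := (vertexLayout ψ).graph (Meets (side ψ)) (Removed ψ (side ψ))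
  k := 75 * side ψ + 1 + 3 * side ψ
  k_pos := by omega

theorem satisfiable_iff_isYes (ψ : PartitionedSAT) : ψ.Satisfiable ↔ (target ψ).IsYes := by
  have hb := one_le_side ψ
  rw [satisfiable_iff ψ hb (n_le_side ψ), MetricDimensionInstance.IsYes]
  constructor
  · rintro ⟨L, hL, h⟩
    obtain ⟨S, hS, hS'⟩ := (vertexLayout ψ).exists_isResolvingSet_of_choice _ _
      (exists_meets hb) L hL h
    rw [card_labels] at hS
    exact ⟨S, hS, hS'⟩
  · rintro ⟨S, hS, hS'⟩
    exact (vertexLayout ψ).exists_choice_of_isResolvingSet _ _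
      (exists_meets hb) (Nat.two_pow_pos _) S (by rw [card_labels]; exact hS) hS'

theorem exists_vertexCoverNum_eq (ψ : PartitionedSAT) :
    ∃ vc : ℕ, (target ψ).graph.vertexCoverNum = (vc : ℕ∞) ∧ vc ≤ 178 * side ψ := by
  have h := (vertexLayout ψ).vertexCoverNum_graph_le (Meets (side ψ)) (Removed ψ (side ψ))
  have hb := one_le_side ψ
  obtain ⟨vc, hvc⟩ := ENat.ne_top_iff_exists.1 (ne_top_of_le_ne_top (ENat.natCast_ne_top _) h)
  refine ⟨vc, hvc.symm, ?_⟩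
  rw [← hvc, card_labels] at h
  have h' : vc ≤ 2 * (75 * side ψ + 1 + 9 * side ψ + 3 * side ψ + 1) := by exact_mod_cast h
  omega

end MetricReduction

namespace RAM

/-! ### Composing runs -/

/-- The invariant is indexed by the number of passes made, so it yields termination after exactly
`N` passes as well as correctness. -/
theorem run_loop {e : Expr} {p : Prog} (Inv : ℕ → State → Prop) {N T : ℕ}
    (step : ∀ i < N, ∀ s, Inv i s → e.eval s ≠ 0 ∧ ∃ s' t, Run p s s' t ∧ Inv (i + 1) s' ∧ t ≤ T)
    (halt : ∀ s, Inv N s → e.eval s = 0) {s : State} (hs : Inv 0 s) :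
    ∃ s' t, Run (.loop e p) s s' t ∧ Inv N s' ∧ t ≤ N * (e.cost + 1 + T) + (e.cost + 1) := by
  have key : ∀ j i, i + j = N → ∀ s, Inv i s →
      ∃ s' t, Run (.loop e p) s s' t ∧ Inv N s' ∧ t ≤ j * (e.cost + 1 + T) + (e.cost + 1) := by
    intro j
    induction j with
    | zero =>
      intro i hi s hs
      rw [add_zero] at hi
      subst hi
      exact ⟨s, _, .loop_done (halt s hs), hs, by omega⟩
    | succ j ih =>
      intro i hi s hs
      obtain ⟨he, s', t, hr, hs', ht⟩ := step i (by omega) s hs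
      obtain ⟨s'', t', hr', hs'', ht'⟩ := ih (i + 1) (by omega) s' hs'
      refine ⟨s'', _, .loop_step he hr hr', hs'', ?_⟩
      rw [Nat.succ_mul]
      omega
  exact key N 0 (by omega) s hs

/-- `s'` differs from `s` at most in the registers from `k` on. -/
structure Same (k : ℕ) (s s' : State) : Prop where
  reg : ∀ r < k, s'.reg r = s.reg r
  mem : s'.mem = s.mem
  out : s'.out = s.out

theorem Same.refl (k : ℕ) (s : State) : Same k s s := ⟨fun _ _ => rfl, rfl, rfl⟩

theorem Same.trans {k : ℕ} {s s' s'' : State} (h : Same k s s') (h' : Same k s' s'') :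
    Same k s s'' :=
  ⟨fun r hr => (h'.reg r hr).trans (h.reg r hr), h'.mem.trans h.mem, h'.out.trans h.out⟩

theorem Same.mono {j k : ℕ} {s s' : State} (h : Same k s s') (hjk : j ≤ k) : Same j s s' :=
  ⟨fun r hr => h.reg r (hr.trans_le hjk), h.mem, h.out⟩

theorem Same.update {j k : ℕ} {s s' : State} (h : Same k s s') (hjk : k ≤ j) (x : ℕ) :
    Same k s { s' with reg := Function.update s'.reg j x } :=
  ⟨fun r hr => by simp [Function.update, show r ≠ j by omega, h.reg r hr], h.mem, h.out⟩

/-- The program `p`, started in `s`, puts `x` into register `k` within `T` steps, and changes no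
other register below `k`. -/
def Evaluates (p : Prog) (k : ℕ) (s : State) (x T : ℕ) : Prop :=
  ∃ s' t, Run p s s' t ∧ Same k s s' ∧ s'.reg k = x ∧ t ≤ T

theorem Evaluates.bind {p q : Prog} {j k : ℕ} {s : State} {x y T T' : ℕ} (hjk : k ≤ j)
    (hp : Evaluates p j s x T) (hq : ∀ s', Same j s s' → s'.reg j = x → Evaluates q k s' y T') :
    Evaluates (.seq p q) k s y (T + T') := by
  obtain ⟨s', t, hr, hs, hx, ht⟩ := hp
  obtain ⟨s'', t', hr', hs', hy, ht'⟩ := hq s' hs hx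
  exact ⟨s'', _, .seq hr hr', (hs.mono hjk).trans hs', hy, by omega⟩

theorem evaluates_assign (k : ℕ) (e : Expr) (s : State) :
    Evaluates (.assign k e) k s (e.eval s) (e.cost + 1) :=
  ⟨_, _, .assign k e s, (Same.refl k s).update le_rfl _, by simp, le_rfl⟩

theorem Evaluates.branch {p q : Prog} {k : ℕ} {s : State} {x T : ℕ} (e : Expr)
    (hp : e.eval s ≠ 0 → Evaluates p k s x T) (hq : e.eval s = 0 → Evaluates q k s x T) :
    Evaluates (.branch e p q) k s x (e.cost + 1 + T) := by
  by_cases h : e.eval s = 0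
  · obtain ⟨s', t, hr, hs, hx, ht⟩ := hq h
    exact ⟨s', _, .branch_neg h hr, hs, hx, by omega⟩
  · obtain ⟨s', t, hr, hs, hx, ht⟩ := hp h
    exact ⟨s', _, .branch_pos h hr, hs, hx, by omega⟩

theorem run_assign_assign (i j : ℕ) (E E' : Expr) (s : State) :
    Run (.seq (.assign i E) (.assign j E')) s
      { s with
        reg := Function.update (Function.update s.reg i (E.eval s)) j
          (E'.eval { s with reg := Function.update s.reg i (E.eval s) }) }
      ((E.cost + 1) + (E'.cost + 1)) :=
  .seq (.assign i E s) (.assign j E' _)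

end RAM

namespace MetricReduction

open RAM

/-! ### Functions that can be computed in polynomial time -/

/-- A formula together with two vertices of its instance of Metric Dimension. -/
structure Input where
  ψ : PartitionedSAT
  u : ℕ
  v : ℕ
  u_lt : u < order (side ψ)
  v_lt : v < order (side ψ)

namespace Input

def mem (a : Input) (i : ℕ) : ℕ := a.ψ.encode.getD i 0

def size (a : Input) : ℕ := order (side a.ψ)

structure Represents (a : Input) (s : State) : Prop where
  reg_zero : s.reg 0 = a.u
  reg_one : s.reg 1 = a.v
  mem : s.mem = a.mem

theorem Represents.same {a : Input} {k : ℕ} {s s' : State} (h : a.Represents s) (hk : 2 ≤ k)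
    (hs : Same k s s') : a.Represents s' :=
  ⟨(hs.reg 0 (by omega)).trans h.reg_zero, (hs.reg 1 (by omega)).trans h.reg_one,
    hs.mem.trans h.mem⟩

end Input

/-- Polynomial in the number of vertices, not in the input length; since that number is `2 ^ O(√N)`,
any degree is good enough. -/
def PolyBound (T : Input → ℕ) : Prop := ∃ C D, ∀ a, T a ≤ C * (a.size + 1) ^ D

namespace PolyBound

theorem mono {S T : Input → ℕ} (h : PolyBound T) (hST : ∀ a, S a ≤ T a) : PolyBound S := by
  obtain ⟨C, D, h⟩ := h
  exact ⟨C, D, fun a => (hST a).trans (h a)⟩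

theorem const (c : ℕ) : PolyBound fun _ => c := ⟨c, 0, fun a => by simp⟩

theorem size : PolyBound Input.size := ⟨1, 1, fun a => by simp⟩

theorem add {S T : Input → ℕ} (hS : PolyBound S) (hT : PolyBound T) :
    PolyBound fun a => S a + T a := by
  obtain ⟨C, D, h⟩ := hS
  obtain ⟨C', D', h'⟩ := hT
  refine ⟨C + C', D + D', fun a => ?_⟩
  have h1 : (a.size + 1) ^ D ≤ (a.size + 1) ^ (D + D') :=
    Nat.pow_le_pow_right (by omega) (by omega)
  have h2 : (a.size + 1) ^ D' ≤ (a.size + 1) ^ (D + D') :=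
    Nat.pow_le_pow_right (by omega) (by omega)
  rw [add_mul]
  exact Nat.add_le_add ((h a).trans (Nat.mul_le_mul_left _ h1))
    ((h' a).trans (Nat.mul_le_mul_left _ h2))

theorem mul {S T : Input → ℕ} (hS : PolyBound S) (hT : PolyBound T) :
    PolyBound fun a => S a * T a := by
  obtain ⟨C, D, h⟩ := hS
  obtain ⟨C', D', h'⟩ := hT
  refine ⟨C * C', D + D', fun a => (Nat.mul_le_mul (h a) (h' a)).trans (le_of_eq ?_)⟩
  ring

end PolyBound

/-- `f` is polynomially bounded and can be computed in polynomial time. -/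
def Poly (f : Input → ℕ) : Prop :=
  PolyBound f ∧ ∀ k, 2 ≤ k → ∃ p T, PolyBound T ∧
    ∀ (a : Input) (s : State), a.Represents s → Evaluates p k s (f a) (T a)

open Classical in
/-- `P` can be decided in polynomial time. -/
def PolyDec (P : Input → Prop) : Prop := Poly fun a => if P a then 1 else 0

namespace Poly

variable {f g h : Input → ℕ}

theorem congr (hf : Poly f) (hfg : ∀ a, f a = g a) : Poly g := by
  rwa [← show f = g from funext hfg]

theorem of_expr {e : Expr} (hB : PolyBound f)
    (he : ∀ (a : Input) s, a.Represents s → e.eval s = f a) : Poly f :=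
  ⟨hB, fun k _ => ⟨.assign k e, fun _ => e.cost + 1, .const _, fun a s hs => by
    rw [← he a s hs]; exact evaluates_assign k e s⟩⟩

theorem const (c : ℕ) : Poly fun _ => c :=
  of_expr (e := .const c) (.const c) fun _ _ _ => rfl

theorem fst : Poly Input.u :=
  of_expr (e := .reg 0) (PolyBound.size.mono fun a => a.u_lt.le) fun _ _ hs => hs.reg_zero

theorem snd : Poly Input.v :=
  of_expr (e := .reg 1) (PolyBound.size.mono fun a => a.v_lt.le) fun _ _ hs => hs.reg_one

/-- The registers serve as a stack: computing the second operand from `k + 1` on preserves the first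
in `k`. -/
theorem map₂ (hf : Poly f) (hg : Poly g) {F : (ℕ → ℕ) → ℕ → ℕ → ℕ}
    (hB : PolyBound fun a => F a.mem (f a) (g a))
    (hF : ∀ k, ∃ e : Expr, ∀ s, e.eval s = F s.mem (s.reg k) (s.reg (k + 1))) :
    Poly fun a => F a.mem (f a) (g a) := by
  refine ⟨hB, fun k hk => ?_⟩
  obtain ⟨p, T, hT, hp⟩ := hf.2 k hk
  obtain ⟨q, T', hT', hq⟩ := hg.2 (k + 1) (by omega)
  obtain ⟨e, he⟩ := hF k
  refine ⟨.seq p (.seq q (.assign k e)), fun a => T a + (T' a + (e.cost + 1)),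
    hT.add (hT'.add (.const _)), fun a s hs => ?_⟩
  refine (hp a s hs).bind le_rfl fun s' hs' hx => ?_
  have hr' := hs.same hk hs'
  refine (hq a s' hr').bind (by omega) fun s'' hs'' hy => ?_
  have hr'' := hr'.same (by omega) hs''
  have := evaluates_assign k e s''
  rwa [he, hr''.mem, hy, hs''.reg k (by omega), hx] at this

theorem add (hf : Poly f) (hg : Poly g) : Poly fun a => f a + g a :=
  hf.map₂ hg (F := fun _ x y => x + y) (hf.1.add hg.1)
    fun k => ⟨.add (.reg k) (.reg (k + 1)), fun _ => rfl⟩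

theorem sub (hf : Poly f) (hg : Poly g) : Poly fun a => f a - g a :=
  hf.map₂ hg (F := fun _ x y => x - y) (hf.1.mono fun _ => Nat.sub_le _ _)
    fun k => ⟨.sub (.reg k) (.reg (k + 1)), fun _ => rfl⟩

theorem load (hf : Poly f) (hB : PolyBound fun a => a.mem (f a)) : Poly fun a => a.mem (f a) :=
  hf.map₂ hf (F := fun m x _ => m x) hB fun k => ⟨.load (.reg k), fun _ => rfl⟩

theorem ite {P : Input → Prop} [∀ a, Decidable (P a)] (hP : PolyDec P) (hf : Poly f)
    (hg : Poly g) : Poly fun a => if P a then f a else g a := by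
  refine ⟨(hf.1.add hg.1).mono fun a => by split_ifs <;> omega, fun k hk => ?_⟩
  obtain ⟨c, T, hT, hc⟩ := hP.2 k hk
  obtain ⟨p, T', hT', hp⟩ := hf.2 k hk
  obtain ⟨q, T'', hT'', hq⟩ := hg.2 k hk
  refine ⟨.seq c (.branch (.reg k) p q), fun a => T a + (2 + (T' a + T'' a)),
    hT.add ((PolyBound.const _).add (hT'.add hT'')), fun a s hs => ?_⟩
  refine (hc a s hs).bind le_rfl fun s' hs' hx => ?_
  have hr' := hs.same hk hs'
  refine Evaluates.branch (.reg k) (fun h => ?_) fun h => ?_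
  · simp only [Expr.eval, hx, ne_eq, ite_eq_right_iff, one_ne_zero, imp_false, not_not] at h
    beta_reduce
    rw [if_pos h]
    obtain ⟨s'', t, h1, h2, h3, h4⟩ := hp a s' hr'
    exact ⟨s'', t, h1, h2, h3, by omega⟩
  · simp only [Expr.eval, hx, ite_eq_right_iff, one_ne_zero, imp_false] at h
    beta_reduce
    rw [if_neg h]
    obtain ⟨s'', t, h1, h2, h3, h4⟩ := hq a s' hr'
    exact ⟨s'', t, h1, h2, h3, by omega⟩

/-- Evaluate three functions into consecutive registers, and go on with `q`. -/
theorem bind₃ {F : Input → ℕ} (hf : Poly f) (hg : Poly g) (hh : Poly h) (hB : PolyBound F)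
    (H : ∀ k, ∃ q T, PolyBound T ∧ ∀ a s, a.Represents s → s.reg k = f a → s.reg (k + 1) = g a →
      s.reg (k + 2) = h a → Evaluates q k s (F a) (T a)) : Poly F := by
  refine ⟨hB, fun k hk => ?_⟩
  obtain ⟨p₁, T₁, hT₁, hp₁⟩ := hf.2 k hk
  obtain ⟨p₂, T₂, hT₂, hp₂⟩ := hg.2 (k + 1) (by omega)
  obtain ⟨p₃, T₃, hT₃, hp₃⟩ := hh.2 (k + 2) (by omega)
  obtain ⟨q, T, hT, hq⟩ := H k
  refine ⟨.seq p₁ (.seq p₂ (.seq p₃ q)), fun a => T₁ a + (T₂ a + (T₃ a + T a)),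
    hT₁.add (hT₂.add (hT₃.add hT)), fun a s hs => ?_⟩
  refine (hp₁ a s hs).bind le_rfl fun s₁ hs₁ hx₁ => ?_
  have hr₁ := hs.same hk hs₁
  refine (hp₂ a s₁ hr₁).bind (by omega) fun s₂ hs₂ hx₂ => ?_
  have hr₂ := hr₁.same (by omega) hs₂
  refine (hp₃ a s₂ hr₂).bind (by omega) fun s₃ hs₃ hx₃ => ?_
  refine hq a s₃ (hr₂.same (by omega) hs₃) ?_ ?_ hx₃
  · rw [hs₃.reg k (by omega), hs₂.reg k (by omega), hx₁]
  · rw [hs₃.reg (k + 1) (by omega), hx₂]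

theorem iterate {F : (ℕ → ℕ) → ℕ → ℕ → ℕ} (hf : Poly f) (hg : Poly g) (hh : Poly h)
    (hB : PolyBound fun a => (fun x => F a.mem x (h a))^[g a] (f a))
    (hF : ∀ k, ∃ e : Expr, ∀ s, e.eval s = F s.mem (s.reg k) (s.reg (k + 2))) :
    Poly fun a => (fun x => F a.mem x (h a))^[g a] (f a) := by
  refine bind₃ hf hg hh hB fun k => ?_
  obtain ⟨e, he⟩ := hF k
  refine ⟨.loop (.reg (k + 1)) (.seq (.assign k e)
    (.assign (k + 1) (.sub (.reg (k + 1)) (.const 1)))),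
    fun a => g a * (1 + 1 + (e.cost + 1 + (3 + 1))) + (1 + 1),
    (hg.1.mul (.const _)).add (.const _), fun a s hs h0 h1 h2 => ?_⟩
  obtain ⟨s', t, hr, ⟨hsame, hi0, hi1, hi2⟩, ht⟩ := run_loop (e := .reg (k + 1)) (N := g a)
    (T := e.cost + 1 + (3 + 1)) (fun i s' => Same k s s' ∧
      s'.reg k = (fun x => F a.mem x (h a))^[i] (f a) ∧ s'.reg (k + 1) = g a - i ∧
      s'.reg (k + 2) = h a) (p := .seq (.assign k e)
    (.assign (k + 1) (.sub (.reg (k + 1)) (.const 1)))) (by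
      rintro i hi s' ⟨hsame, hi0, hi1, hi2⟩
      refine ⟨by simp [Expr.eval, hi1]; omega, _, _, run_assign_assign _ _ _ _ _, ⟨?_, ?_, ?_, ?_⟩,
        le_rfl⟩
      · exact (hsame.update le_rfl _).update (by omega) _
      · simp only [Function.update, Function.iterate_succ_apply', he, hsame.mem, hs.mem, hi0, hi2]
        simp
      · simp only [Function.update, Expr.eval]
        simp [hi1]
        omega
      · simp [Function.update, hi2]) (by
      rintro s' ⟨hsame, hi0, hi1, hi2⟩
      simp [Expr.eval, hi1]) (s := s) ⟨Same.refl _ _, h0, by simpa using h1, h2⟩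
  exact ⟨s', t, hr, hsame, hi0, ht⟩

theorem mul (hf : Poly f) (hg : Poly g) : Poly fun a => f a * g a := by
  have key : ∀ c n : ℕ, (fun x => x + c)^[n] 0 = c * n := by
    intro c n
    induction n with
    | zero => rfl
    | succ n ih => rw [Function.iterate_succ_apply', ih, Nat.mul_succ]
  refine (iterate (F := fun _ x c => x + c) (const 0) hg hf ?_
    fun k => ⟨.add (.reg k) (.reg (k + 2)), fun _ => rfl⟩).congr fun a => key _ _
  simpa only [key] using hf.1.mul hg.1

theorem two_pow (hf : Poly f) (hB : PolyBound fun a => 2 ^ f a) : Poly fun a => 2 ^ f a := by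
  have key : ∀ n : ℕ, (fun x => x + x)^[n] 1 = 2 ^ n := by
    intro n
    induction n with
    | zero => rfl
    | succ n ih => rw [Function.iterate_succ_apply', ih, pow_succ, Nat.mul_two]
  refine (iterate (F := fun _ x _ => x + x) (const 1) hf (const 0) ?_
    fun k => ⟨.add (.reg k) (.reg k), fun _ => rfl⟩).congr fun a => key _
  simpa only [key] using hB

theorem div (hf : Poly f) (hg : Poly g) : Poly fun a => f a / g a := by
  refine bind₃ (const 0) hf hg (hf.1.mono fun _ => Nat.div_le_self _ _) fun k => ?_
  -- Repeated subtraction: `x + 1 - y` is nonzero exactly if `y ≤ x`. The branch avoids an endless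
  -- loop for divisor `0`, where the quotient is `0`.
  refine ⟨.branch (.reg (k + 2)) (.loop (.sub (.add (.reg (k + 1)) (.const 1)) (.reg (k + 2)))
    (.seq (.assign k (.add (.reg k) (.const 1)))
      (.assign (k + 1) (.sub (.reg (k + 1)) (.reg (k + 2)))))) .skip,
    fun a => 2 + (f a * (6 + (4 + 4)) + 6), (PolyBound.const _).add ((hf.1.mul (.const _)).add
      (.const _)), fun a s hs h0 h1 h2 => ?_⟩
  refine Evaluates.branch (.reg (k + 2)) (fun hne => ?_) fun heq => ?_
  · simp only [Expr.eval, h2] at hne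
    have hpos := Nat.pos_of_ne_zero hne
    obtain ⟨s', t, hr, ⟨hsame, hi0, hi1, hi2⟩, ht⟩ := run_loop
      (e := .sub (.add (.reg (k + 1)) (.const 1)) (.reg (k + 2)))
      (p := .seq (.assign k (.add (.reg k) (.const 1)))
        (.assign (k + 1) (.sub (.reg (k + 1)) (.reg (k + 2)))))
      (N := f a / g a) (T := 4 + 4) (fun i s' => Same k s s' ∧
      s'.reg k = i ∧ s'.reg (k + 1) = f a - i * g a ∧ s'.reg (k + 2) = g a) (by
        rintro i hi s' ⟨hsame, hi0, hi1, hi2⟩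
        have hle : (i + 1) * g a ≤ f a :=
          (Nat.mul_le_mul_right _ hi).trans (Nat.div_mul_le_self _ _)
        rw [Nat.succ_mul] at hle
        refine ⟨by simp [Expr.eval, hi1, hi2]; omega, _, _, run_assign_assign _ _ _ _ _,
          ⟨?_, ?_, ?_, ?_⟩, le_rfl⟩
        · exact (hsame.update le_rfl _).update (by omega) _
        · simp [Function.update, Expr.eval, hi0]
        · simp [Function.update, Expr.eval, hi1, hi2, Nat.succ_mul]
          omega
        · simp [Function.update, hi2]) (by
        rintro s' ⟨hsame, hi0, hi1, hi2⟩
        have h3 := Nat.div_add_mod' (f a) (g a)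
        have h4 := Nat.mod_lt (f a) hpos
        simp only [Expr.eval, hi1, hi2]
        omega) (s := s) ⟨Same.refl _ _, h0, by simpa using h1, h2⟩
    refine ⟨s', t, hr, hsame, hi0, ht.trans ?_⟩
    simp only [Expr.cost]
    have := Nat.mul_le_mul_right 14 (Nat.div_le_self (f a) (g a))
    omega
  · simp only [Expr.eval, h2] at heq
    exact ⟨s, _, .skip s, Same.refl _ _, by simp [h0, heq], by omega⟩

theorem mod (hf : Poly f) (hg : Poly g) : Poly fun a => f a % g a :=
  (hf.sub (hg.mul (hf.div hg))).congr fun a => by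
    have := Nat.div_add_mod (f a) (g a)
    omega

/-- Register `k + 2` runs through the powers of `c` until it reaches `f a`. As there is no
multiplication instruction, `hmul` supplies the factor `c` by additions. -/
theorem clog {c : ℕ} (hc : 1 < c) (hf : Poly f)
    (hmul : ∀ r, ∃ e : Expr, ∀ s, e.eval s = s.reg r * c) : Poly fun a => Nat.clog c (f a) := by
  have clog_le : ∀ x, Nat.clog c x ≤ x := fun x => Nat.clog_le_of_le_pow (Nat.lt_pow_self hc).le
  refine bind₃ (const 0) hf (const 1) (hf.1.mono fun _ => clog_le _) fun k => ?_
  obtain ⟨e, he⟩ := hmul (k + 2)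
  refine ⟨.loop (.sub (.reg (k + 1)) (.reg (k + 2)))
    (.seq (.assign k (.add (.reg k) (.const 1))) (.assign (k + 2) e)),
    fun a => f a * (4 + (4 + (e.cost + 1))) + 4, (hf.1.mul (.const _)).add
      (.const _), fun a s hs h0 h1 h2 => ?_⟩
  obtain ⟨s', t, hr, ⟨hsame, hi0, hi1, hi2⟩, ht⟩ := run_loop
    (e := .sub (.reg (k + 1)) (.reg (k + 2)))
    (p := .seq (.assign k (.add (.reg k) (.const 1))) (.assign (k + 2) e))
    (N := Nat.clog c (f a)) (T := 4 + (e.cost + 1)) (fun i s' => Same k s s' ∧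
    s'.reg k = i ∧ s'.reg (k + 1) = f a ∧ s'.reg (k + 2) = c ^ i) (by
      rintro i hi s' ⟨hsame, hi0, hi1, hi2⟩
      have hlt := Nat.pow_lt_of_lt_clog hi
      refine ⟨by simp [Expr.eval, hi1, hi2]; omega, _, _, run_assign_assign _ _ _ _ _,
        ⟨?_, ?_, ?_, ?_⟩, le_rfl⟩
      · exact (hsame.update le_rfl _).update (by omega) _
      · simp [Function.update, Expr.eval, hi0]
      · simp [Function.update, hi1]
      · simp [Function.update, he, hi2, pow_succ]) (by
      rintro s' ⟨hsame, hi0, hi1, hi2⟩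
      have := Nat.le_pow_clog hc (f a)
      simp only [Expr.eval, hi1, hi2]
      omega) (s := s) ⟨Same.refl _ _, h0, h1, by simpa using h2⟩
  refine ⟨s', t, hr, hsame, hi0, ht.trans ?_⟩
  exact Nat.add_le_add_right (Nat.mul_le_mul_right _ (clog_le _)) _

theorem clog_two (hf : Poly f) : Poly fun a => Nat.clog 2 (f a) :=
  hf.clog (by norm_num) fun r => ⟨.add (.reg r) (.reg r), fun s => by simp [Expr.eval]; omega⟩

theorem clog_four (hf : Poly f) : Poly fun a => Nat.clog 4 (f a) :=
  hf.clog (by norm_num) fun r => ⟨.add (.add (.reg r) (.reg r)) (.add (.reg r) (.reg r)),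
    fun s => by simp [Expr.eval]; omega⟩

end Poly

namespace PolyDec

open Classical

variable {P Q : Input → Prop} {f g : Input → ℕ}

theorem congr (hP : PolyDec P) (hPQ : ∀ a, P a ↔ Q a) : PolyDec Q := by
  rwa [← show P = Q from funext fun a => propext (hPQ a)]

theorem not (hP : PolyDec P) : PolyDec fun a => ¬ P a :=
  ((Poly.const 1).sub hP).congr fun a => by by_cases h : P a <;> simp [h]

theorem and (hP : PolyDec P) (hQ : PolyDec Q) : PolyDec fun a => P a ∧ Q a :=
  (Poly.mul hP hQ).congr fun a => by by_cases h : P a <;> by_cases h' : Q a <;> simp [h, h']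

theorem or (hP : PolyDec P) (hQ : PolyDec Q) : PolyDec fun a => P a ∨ Q a :=
  (hP.not.and hQ.not).not.congr fun a => by tauto

theorem le (hf : Poly f) (hg : Poly g) : PolyDec fun a => f a ≤ g a :=
  ((Poly.const 1).sub (hf.sub hg)).congr fun a => by split_ifs <;> omega

theorem lt (hf : Poly f) (hg : Poly g) : PolyDec fun a => f a < g a :=
  (le hg hf).not.congr fun a => by omega

theorem eq (hf : Poly f) (hg : Poly g) : PolyDec fun a => f a = g a :=
  ((le hf hg).and (le hg hf)).congr fun a => by omega

theorem ne (hf : Poly f) (hg : Poly g) : PolyDec fun a => f a ≠ g a := (eq hf hg).not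

end PolyDec

end MetricReduction

namespace MetricReduction

open RAM

/-! ### Reading the formula -/

section Encoding

variable {n : ℕ}

def literalCode (l : Literal n) : List ℕ :=
  [(l.part : ℕ), (l.index : ℕ), if l.positive then 1 else 0]

def clauseCode (C : List (Literal n)) : List ℕ := C.length :: C.flatMap literalCode

theorem encode_eq (ψ : PartitionedSAT) :
    ψ.encode = [ψ.n, ψ.clauses.length] ++ ψ.clauses.flatMap clauseCode := rfl

theorem length_clauseCode (C : List (Literal n)) : (clauseCode C).length = 1 + 3 * C.length := by
  simp [clauseCode, literalCode, List.length_flatMap, mul_comm, add_comm]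

/-- The address of the code of a clause. -/
def address (mem : ℕ → ℕ) (r : ℕ) : ℕ := (fun x => x + 1 + 3 * mem x)^[r] 2

/-- A clause code starts with its length `m` and occupies `1 + 3 * m` cells, so one iteration jumps
to the next clause. -/
theorem exists_append_eq_of_iterate (w : List ℕ) (r : ℕ) :
    ∀ (cs : List (List (Literal n))) (pre : List ℕ) (hr : r < cs.length),
      w = pre ++ cs.flatMap clauseCode → ∃ pre' post, w = pre' ++ (clauseCode cs[r] ++ post) ∧
        (fun x => x + 1 + 3 * w.getD x 0)^[r] pre.length = pre'.length := by
  induction r with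
  | zero =>
    intro cs pre hr hw
    rcases cs with _ | ⟨C, cs⟩
    · simp at hr
    · exact ⟨pre, cs.flatMap clauseCode, by simpa using hw, rfl⟩
  | succ r ih =>
    intro cs pre hr hw
    rcases cs with _ | ⟨C, cs⟩
    · simp at hr
    · obtain ⟨pre', post, h1, h2⟩ := ih cs (pre ++ clauseCode C) (by simpa using hr)
        (by simpa using hw)
      refine ⟨pre', post, by simpa using h1, ?_⟩
      rw [← h2, Function.iterate_succ_apply]
      congr 1
      have : w.getD pre.length 0 = C.length := by
        rw [hw, List.getD_append_right _ _ _ _ le_rfl]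
        simp [clauseCode]
      rw [this, List.length_append, length_clauseCode]
      omega

theorem getD_address (ψ : PartitionedSAT) {r : ℕ} (hr : r < ψ.clauses.length) :
    ∃ post, ∀ i, ψ.encode.getD (address (fun i => ψ.encode.getD i 0) r + i) 0 =
      (clauseCode ψ.clauses[r] ++ post).getD i 0 := by
  obtain ⟨pre, post, h1, h2⟩ := exists_append_eq_of_iterate ψ.encode r ψ.clauses
    [ψ.n, ψ.clauses.length] hr (encode_eq ψ)
  refine ⟨post, fun i => ?_⟩
  rw [address]
  erw [h2]
  rw [h1, List.getD_append_right _ _ _ _ (by omega)]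
  simp

/-- The `i`-th literal of clause `r` suppresses the edge to portal `p`. -/
def RemovedBySlot (mem : ℕ → ℕ) (b r p i : ℕ) : Prop :=
  i < mem (address mem r + 0) ∧ RemovedBy b p (mem (address mem r + (1 + 3 * i)))
    (mem (address mem r + (2 + 3 * i))) (mem (address mem r + (3 + 3 * i)))

theorem removed_iff (ψ : PartitionedSAT) (b p : ℕ) {r : ℕ} (hr : r < ψ.clauses.length) :
    Removed ψ b r p ↔ RemovedBySlot (fun i => ψ.encode.getD i 0) b r p 0 ∨
      RemovedBySlot (fun i => ψ.encode.getD i 0) b r p 1 ∨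
      RemovedBySlot (fun i => ψ.encode.getD i 0) b r p 2 := by
  obtain ⟨post, h⟩ := getD_address ψ hr
  have hlen := ψ.length_le _ (List.getElem_mem hr)
  simp only [Removed, List.getD_eq_getElem _ _ hr, RemovedBySlot, h]
  generalize ψ.clauses[r] = C at hlen
  rcases C with _ | ⟨l₀, _ | ⟨l₁, _ | ⟨l₂, _ | ⟨l₃, C⟩⟩⟩⟩
  · simp [clauseCode]
  · simp [clauseCode, literalCode]
  · simp [clauseCode, literalCode]
  · simp [clauseCode, literalCode]
  · simp at hlen
    omega

end Encoding

/-! ### The adjacency relation is polynomial-time decidable -/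

theorem base_le_order (b : ℕ) : base b ≤ order b := by
  have : base b ≤ base b ^ 5 := Nat.le_self_pow (by norm_num) _
  rw [order]
  omega

/-- Values read from memory must be polynomially bounded, because they may control the length of a
loop. -/
theorem Input.mem_le (a : Input) (i : ℕ) : a.mem i ≤ a.size := by
  have hb := one_le_side a.ψ
  have hP := base_bounds hb
  have hn : a.ψ.n ≤ order (side a.ψ) := by
    have h1 := n_le_side a.ψ
    have h2 : side a.ψ * side a.ψ ≤ base (side a.ψ) * base (side a.ψ) :=
      Nat.mul_le_mul (by omega) (by omega)
    have h3 : base (side a.ψ) * base (side a.ψ) * 1 ≤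
        base (side a.ψ) * base (side a.ψ) * base (side a.ψ) ^ 3 :=
      Nat.mul_le_mul_left _ (Nat.one_le_pow _ _ base_pos)
    have h4 : base (side a.ψ) * base (side a.ψ) * base (side a.ψ) ^ 3 = base (side a.ψ) ^ 5 := by
      ring
    rw [order]
    omega
  have hP' := base_le_order (side a.ψ)
  have hm := length_clauses_le a.ψ
  have key : ∀ x ∈ a.ψ.encode, x ≤ order (side a.ψ) := by
    intro x hx
    simp only [encode_eq, List.mem_append, List.mem_cons, List.not_mem_nil, or_false,
      List.mem_flatMap, clauseCode, literalCode] at hx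
    rcases hx with (rfl | rfl) | ⟨C, hC, rfl | ⟨l, -, rfl | rfl | rfl⟩⟩
    · exact hn
    · omega
    · have := a.ψ.length_le C hC
      omega
    · omega
    · omega
    · split_ifs <;> omega
  simp only [Input.mem, Input.size]
  by_cases h : i < a.ψ.encode.length
  · rw [List.getD_eq_getElem _ _ h]
    exact key _ (List.getElem_mem h)
  · rw [List.getD_eq_default _ _ (by omega)]
    exact Nat.zero_le _

theorem Poly.load' {f : Input → ℕ} (hf : Poly f) : Poly fun a => a.mem (f a) :=
  hf.load (PolyBound.size.mono fun a => a.mem_le _)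

theorem poly_length : Poly fun a => a.ψ.clauses.length :=
  (Poly.const 1).load'.congr fun _ => rfl

theorem two_pow_side_le (a : Input) : 2 ^ side a.ψ ≤ a.size :=
  (base_bounds (one_le_side a.ψ)).2.1.le.trans (base_le_order _)

theorem poly_side : Poly fun a => side a.ψ :=
  Poly.two_pow (f := fun a => Nat.clog 4 a.ψ.n)
    ((Poly.const 0).load'.congr (g := fun a => a.ψ.n) fun _ => rfl).clog_four
    (PolyBound.size.mono fun a => Nat.lt_two_pow_self.le.trans (two_pow_side_le a))

theorem poly_base : Poly fun a => base (side a.ψ) :=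
  Poly.two_pow ((Poly.const 15).mul poly_side) (PolyBound.size.mono fun _ => base_le_order _)

theorem poly_order : Poly fun a => order (side a.ψ) :=
  ((Poly.const 2).mul ((((poly_base.mul poly_base).mul poly_base).mul poly_base).mul
    poly_base)).congr fun a => by rw [order]; ring

theorem poly_k : Poly fun a => (target a.ψ).k :=
  (((Poly.const 75).mul poly_side).add (Poly.const 1)).add ((Poly.const 3).mul poly_side)

section

variable {f g h l : Input → ℕ}

theorem polyDec_isForced (hf : Poly f) : PolyDec fun a => IsForced (f a) := by
  have hx := hf.div (.const 2)
  refine (PolyDec.eq hx (.const 0)).or (PolyDec.eq (Poly.two_pow hx.clog_two ?_) hx)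
  -- Rounding `x` up to a power of two at most doubles it, apart from the small values of `x`.
  refine ((PolyBound.const 1).add (hx.1.mul (.const 2))).mono fun a => ?_
  rcases Nat.lt_or_ge 1 (f a / 2) with h | h
  · have h1 := Nat.pow_pred_clog_lt_self (b := 2) (by norm_num) h
    have h2 := Nat.clog_pos (b := 2) (by norm_num) h
    obtain ⟨k, hk⟩ : ∃ k, Nat.clog 2 (f a / 2) = k + 1 := ⟨_, (Nat.succ_pred_eq_of_pos h2).symm⟩
    rw [hk] at h1 ⊢
    simp only [Nat.pred_eq_sub_one, Nat.add_sub_cancel] at h1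
    rw [pow_succ]
    omega
  · rw [Nat.clog_of_right_le_one h]
    omega

theorem polyDec_isPortal (hf : Poly f) : PolyDec fun a => IsPortal (side a.ψ) (f a) :=
  have hx := hf.div (.const 2)
  (PolyDec.eq (hx.div poly_base) (.const 6)).and
    (PolyDec.lt (hx.mod poly_base) ((Poly.const 9).mul poly_side))

theorem polyDec_isAssign (hf : Poly f) : PolyDec fun a => IsAssign (side a.ψ) (f a) :=
  have hx := hf.div (.const 2)
  have hQ := poly_base.mul poly_base
  (PolyDec.eq (hx.mod hQ) (.const 0)).and
    ((PolyDec.eq (((hx.div hQ).div poly_base).div poly_base) (.const 3)).and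
    ((PolyDec.lt (((hx.div hQ).div poly_base).mod poly_base) ((Poly.const 3).mul poly_side)).and
    (PolyDec.lt ((hx.div hQ).mod poly_base)
      (poly_side.two_pow (PolyBound.size.mono two_pow_side_le)))))

theorem polyDec_isClause (hf : Poly f) :
    PolyDec fun a => IsClause (side a.ψ) a.ψ.clauses.length (f a) :=
  have hx := hf.div (.const 2)
  (PolyDec.eq (hx.div poly_base) (.const 3)).and (PolyDec.lt (hx.mod poly_base) poly_length)

theorem polyDec_isBucket (hf : Poly f) : PolyDec fun a => IsBucket (side a.ψ) (f a) :=
  have hx := hf.div (.const 2)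
  (PolyDec.eq (hx.div poly_base) (.const 5)).and
    (PolyDec.lt (hx.mod poly_base) ((Poly.const 3).mul poly_side))

theorem polyDec_isHub (hf : Poly f) : PolyDec fun a => IsHub (side a.ψ) (f a) :=
  PolyDec.eq (hf.add (.const 1)) poly_order

open Classical in
theorem poly_tag (hf : Poly f) : Poly fun a => tag (side a.ψ) a.ψ.clauses.length (f a) :=
  .ite (polyDec_isForced hf) (.const 0) <| .ite (polyDec_isPortal hf) (.const 1) <|
    .ite (polyDec_isAssign hf) (.const 2) <| .ite (polyDec_isClause hf) (.const 3) <|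
    .ite (polyDec_isBucket hf) (.const 4) <| .ite (polyDec_isHub hf) (.const 5) (.const 6)

theorem poly_par (hf : Poly f) : Poly fun a => par (side a.ψ) a.ψ.clauses.length (f a) :=
  have hx := hf.div (.const 2)
  have ht := poly_tag hf
  .ite (.eq ht (.const 0)) hx <| .ite (.eq ht (.const 2))
    (((hx.div (poly_base.mul poly_base)).div poly_base).mod poly_base) <|
    .ite (.eq ht (.const 5)) (.const 0) (hx.mod poly_base)

theorem poly_par' (hf : Poly f) : Poly fun a => par' (side a.ψ) a.ψ.clauses.length (f a) :=
  .ite (.eq (poly_tag hf) (.const 2))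
    (((hf.div (.const 2)).div (poly_base.mul poly_base)).mod poly_base) (.const 0)

theorem polyDec_bit (hf : Poly f) (hg : Poly g) :
    PolyDec fun a => bit (side a.ψ) a.ψ.clauses.length (f a) (g a) :=
  have hx := hf.div (.const 2)
  have ht := poly_tag hf
  ((PolyDec.eq hg (.const 0)).and ((PolyDec.eq hx (.const 0)).or
    ((PolyDec.eq (hf.mod (.const 2)) (.const 1)).and ((PolyDec.ne ht (.const 0)).and
    ((PolyDec.ne ht (.const 3)).and (PolyDec.ne ht (.const 4))))))).or
  ((PolyDec.ne hg (.const 0)).and (PolyDec.eq ((hx.div hg).mod (.const 2)) (.const 1)))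

theorem polyDec_meets (hf : Poly f) (hg : Poly g) (hh : Poly h) :
    PolyDec fun a => Meets (side a.ψ) (f a) (g a) (h a) :=
  have hb := poly_side
  have ht := (hf.div hb).mod (.const 3)
  have hj := hf.mod hb
  have hs : Poly fun a => h a / 2 ^ (f a % side a.ψ) % 2 :=
    (hh.div (hj.two_pow (PolyBound.size.mono fun a => (Nat.pow_le_pow_right (by norm_num)
      (Nat.mod_lt _ (one_le_side a.ψ)).le).trans (two_pow_side_le a)))).mod (.const 2)
  (PolyDec.eq ((hf.div hb).div (.const 3)) (hg.div hb)).and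
    (((PolyDec.eq ht (.const 0)).and (.eq hj (hg.mod hb))).or
    (((PolyDec.eq ht (.const 1)).and (.eq hs (.const 1))).or
    ((PolyDec.eq ht (.const 2)).and (.eq hs (.const 0)))))

theorem polyDec_removedBy (hf : Poly f) (hg : Poly g) (hh : Poly h) (hl : Poly l) :
    PolyDec fun a => RemovedBy (side a.ψ) (f a) (g a) (h a) (l a) :=
  have hb := poly_side
  have ht := (hf.div hb).mod (.const 3)
  have hj := hf.mod hb
  (PolyDec.eq ((hf.div hb).div (.const 3)) hg).and
    (((PolyDec.eq ht (.const 0)).and (.eq hj (hh.div hb))).or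
    ((PolyDec.ne ht (.const 0)).and
      ((PolyDec.eq hj (hh.mod hb)).and (.eq ht ((Poly.const 1).add hl))).not))

theorem poly_address (hf : Poly f) : Poly fun a => address a.mem (f a) := by
  refine Poly.iterate (F := fun m x _ => x + 1 + 3 * m x) (.const 2) hf (.const 0) ?_ fun k =>
    ⟨.add (.add (.reg k) (.const 1)) (.add (.load (.reg k)) (.add (.load (.reg k))
      (.load (.reg k)))), fun s => by simp only [Expr.eval]; ring⟩
  refine ((PolyBound.const 2).add (hf.1.mul ((PolyBound.const 1).add
    ((PolyBound.const 3).mul .size)))).mono fun a => ?_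
  generalize f a = r
  induction r with
  | zero => simp
  | succ r ih =>
    rw [Function.iterate_succ_apply', add_one_mul]
    have := a.mem_le ((fun x => x + 1 + 3 * a.mem x)^[r] 2)
    omega

theorem polyDec_removedBySlot (hf : Poly f) (hg : Poly g) (i : ℕ) :
    PolyDec fun a => RemovedBySlot a.mem (side a.ψ) (f a) (g a) i :=
  have field (c : ℕ) : Poly fun a => a.mem (address a.mem (f a) + c) :=
    ((poly_address hf).add (.const c)).load'
  (PolyDec.lt (.const i) (field 0)).and (polyDec_removedBy hg (field _) (field _) (field _))

/-- The relation `Layout.Rel`, in terms of the encoding of the formula. -/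
def CodeRel (ψ : PartitionedSAT) (mem : ℕ → ℕ) (u v : ℕ) : Prop :=
  let b := side ψ
  let m := ψ.clauses.length
  (tag b m u = 0 ∧ bit b m v (par b m u)) ∨
  (tag b m u = 1 ∧ tag b m v = 2 ∧ Meets b (par b m u) (par b m v) (par' b m v)) ∨
  (tag b m u = 1 ∧ tag b m v = 3 ∧ (v % 2 = 1 ∨ ¬ (RemovedBySlot mem b (par b m v) (par b m u) 0 ∨
    RemovedBySlot mem b (par b m v) (par b m u) 1 ∨
    RemovedBySlot mem b (par b m v) (par b m u) 2))) ∨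
  (tag b m u = 4 ∧ u % 2 ≠ 1 ∧ tag b m v = 2 ∧ par b m u = par b m v) ∨
  (tag b m u = 5 ∧ tag b m v ≠ 2)

theorem polyDec_codeRel (hf : Poly f) (hg : Poly g) :
    PolyDec fun a => CodeRel a.ψ a.mem (f a) (g a) :=
  have htf := poly_tag hf
  have htg := poly_tag hg
  have hxf := poly_par hf
  have hxg := poly_par hg
  ((PolyDec.eq htf (.const 0)).and (polyDec_bit hg hxf)).or <|
  ((PolyDec.eq htf (.const 1)).and ((PolyDec.eq htg (.const 2)).and
    (polyDec_meets hxf hxg (poly_par' hg)))).or <|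
  ((PolyDec.eq htf (.const 1)).and ((PolyDec.eq htg (.const 3)).and
    ((PolyDec.eq (hg.mod (.const 2)) (.const 1)).or ((polyDec_removedBySlot hxg hxf 0).or
      ((polyDec_removedBySlot hxg hxf 1).or (polyDec_removedBySlot hxg hxf 2))).not))).or <|
  ((PolyDec.eq htf (.const 4)).and ((PolyDec.ne (hf.mod (.const 2)) (.const 1)).and
    ((PolyDec.eq htg (.const 2)).and (PolyDec.eq hxf hxg)))).or <|
  ((PolyDec.eq htf (.const 5)).and (PolyDec.ne htg (.const 2)))

end

def CodeAdj (ψ : PartitionedSAT) (u v : ℕ) : Prop :=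
  u ≠ v ∧ (CodeRel ψ (fun i => ψ.encode.getD i 0) u v ∨
    CodeRel ψ (fun i => ψ.encode.getD i 0) v u)

theorem polyDec_codeAdj : PolyDec fun a => CodeAdj a.ψ a.u a.v :=
  (PolyDec.ne .fst .snd).and ((polyDec_codeRel .fst .snd).or (polyDec_codeRel .snd .fst))

/-- The slots in memory describe `Removed` only for indices of actual clauses; tag `3` guarantees
this. -/
theorem rel_iff_codeRel (ψ : PartitionedSAT) (u v : Fin (order (side ψ))) :
    (vertexLayout ψ).Rel (Meets (side ψ)) (Removed ψ (side ψ)) u v ↔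
      CodeRel ψ (fun i => ψ.encode.getD i 0) u v := by
  have hlt : tag (side ψ) ψ.clauses.length v = 3 → par (side ψ) ψ.clauses.length v <
    ψ.clauses.length := (vertexLayout ψ).clause_lt v
  have h3 : ∀ p, (tag (side ψ) ψ.clauses.length v = 3 ∧ ((v : ℕ) % 2 = 1 ∨
      ¬ Removed ψ (side ψ) (par (side ψ) ψ.clauses.length v) p)) ↔
      (tag (side ψ) ψ.clauses.length v = 3 ∧ ((v : ℕ) % 2 = 1 ∨
      ¬ (RemovedBySlot (fun i => ψ.encode.getD i 0) (side ψ) (par (side ψ) ψ.clauses.length v) p 0 ∨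
        RemovedBySlot (fun i => ψ.encode.getD i 0) (side ψ) (par (side ψ) ψ.clauses.length v) p 1 ∨
        RemovedBySlot (fun i => ψ.encode.getD i 0) (side ψ)
          (par (side ψ) ψ.clauses.length v) p 2))) :=
    fun p => and_congr_right fun h => by rw [removed_iff ψ _ _ (hlt h)]
  simp only [Layout.Rel, vertexLayout, layout, CodeRel, decide_eq_true_eq, decide_eq_false_iff_not,
    h3, ne_eq]

theorem adj_iff_codeAdj (ψ : PartitionedSAT) (u v : Fin (order (side ψ))) :
    (target ψ).graph.Adj u v ↔ CodeAdj ψ u v := by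
  simp only [target, Layout.graph, rel_iff_codeRel, CodeAdj, ne_eq, Fin.ext_iff]

open Classical in
theorem encode_target (ψ : PartitionedSAT) :
    (target ψ).encode = [(target ψ).k, order (side ψ)] ++
      (List.range (order (side ψ))).flatMap fun u =>
        (List.range (order (side ψ))).map fun v => if CodeAdj ψ u v then 1 else 0 := by
  simp only [MetricDimensionInstance.encode, List.cons_append, List.nil_append]
  congr 2
  rw [← List.map_coe_finRange_eq_range, List.flatMap_map]
  simp only [List.map_map]
  congr 1
  funext u
  congr 1
  funext v
  exact if_congr (adj_iff_codeAdj ψ u v) rfl rfl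

end MetricReduction

namespace MetricReduction

open RAM

/-! ### The program -/

/-- Print the row of the adjacency matrix whose number is in register `0`. -/
def rowLoop (p : Prog) : Prog :=
  .loop (.sub (.reg 2) (.reg 1))
    (.seq p (.seq (.emit (.reg 3)) (.assign 1 (.add (.reg 1) (.const 1)))))

def matrixLoop (p : Prog) : Prog :=
  .loop (.sub (.reg 2) (.reg 0))
    (.seq (.assign 1 (.const 0)) (.seq (rowLoop p) (.assign 0 (.add (.reg 0) (.const 1)))))

section

variable {p : Prog} {n τ : ℕ} {mem : ℕ → ℕ} {A : ℕ → ℕ → ℕ}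

theorem run_rowLoop (hp : ∀ i < n, ∀ j < n, ∀ s : State, s.reg 0 = i → s.reg 1 = j → s.mem = mem →
      Evaluates p 3 s (A i j) τ) {i : ℕ} (hi : i < n) {s : State} (h0 : s.reg 0 = i)
    (h1 : s.reg 1 = 0) (h2 : s.reg 2 = n) (hm : s.mem = mem) :
    ∃ s' t, Run (rowLoop p) s s' t ∧ (s'.reg 0 = i ∧ s'.reg 2 = n ∧ s'.mem = mem ∧
      s'.out = s.out ++ (List.range n).map (A i)) ∧ t ≤ n * (τ + 10) + 4 := by
  obtain ⟨s', t, hr, ⟨h0, -, h2, hm, ho⟩, ht⟩ := run_loop (e := .sub (.reg 2) (.reg 1))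
    (p := .seq p (.seq (.emit (.reg 3)) (.assign 1 (.add (.reg 1) (.const 1)))))
    (N := n) (T := τ + (2 + 4)) (fun j s' => s'.reg 0 = i ∧ s'.reg 1 = j ∧ s'.reg 2 = n ∧
      s'.mem = mem ∧ s'.out = s.out ++ (List.range j).map (A i)) (by
      rintro j hj s₁ ⟨h0, h1, h2, hm, ho⟩
      refine ⟨by simp [Expr.eval, h1, h2]; omega, ?_⟩
      obtain ⟨s₂, t, hr, hs, hx, ht⟩ := hp i hi j hj s₁ h0 h1 hm
      refine ⟨_, _, .seq hr (.seq (.emit _ _) (.assign _ _ _)), ⟨?_, ?_, ?_, ?_, ?_⟩,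
        Nat.add_le_add_right ht _⟩
      · simp [Function.update, hs.reg 0 (by omega), h0]
      · simp [Expr.eval, hs.reg 1 (by omega), h1]
      · simp [Function.update, hs.reg 2 (by omega), h2]
      · simp [hs.mem, hm]
      · simp [Expr.eval, hs.out, ho, hx, List.range_succ]) (by
      rintro s₁ ⟨-, h1, h2, -, -⟩
      simp [Expr.eval, h1, h2]) (s := s) ⟨h0, h1, h2, hm, by simp⟩
  refine ⟨s', t, hr, ⟨h0, h2, hm, ho⟩, ht.trans (le_of_eq ?_)⟩
  simp only [Expr.cost]
  ring

theorem run_matrixLoop (hp : ∀ i < n, ∀ j < n, ∀ s : State, s.reg 0 = i → s.reg 1 = j →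
      s.mem = mem → Evaluates p 3 s (A i j) τ) {s : State} (h0 : s.reg 0 = 0)
    (h2 : s.reg 2 = n) (hm : s.mem = mem) :
    ∃ s' t, Run (matrixLoop p) s s' t ∧
      s'.out = s.out ++ ((List.range n).flatMap fun i => (List.range n).map (A i)) ∧
      t ≤ n * (n * (τ + 10) + 14) + 4 := by
  obtain ⟨s', t, hr, ⟨-, -, -, ho⟩, ht⟩ := run_loop (e := .sub (.reg 2) (.reg 0))
    (p := .seq (.assign 1 (.const 0)) (.seq (rowLoop p) (.assign 0 (.add (.reg 0) (.const 1)))))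
    (N := n) (T := 2 + (n * (τ + 10) + 4 + 4)) (fun i s' => s'.reg 0 = i ∧ s'.reg 2 = n ∧
      s'.mem = mem ∧ s'.out = s.out ++ ((List.range i).flatMap fun i => (List.range n).map (A i)))
      (by
      rintro i hi s₁ ⟨h0, h2, hm, ho⟩
      refine ⟨by simp [Expr.eval, h0, h2]; omega, ?_⟩
      obtain ⟨s₂, t, hr, ⟨h0', h2', hm', ho'⟩, ht⟩ := run_rowLoop hp hi
        (s := { s₁ with reg := Function.update s₁.reg 1 ((Expr.const 0).eval s₁) })
        (by simp [Function.update, h0]) (by simp [Expr.eval])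
        (by simp [Function.update, h2]) (by simpa using hm)
      refine ⟨_, _, .seq (.assign _ _ _) (.seq hr (.assign _ _ _)), ⟨?_, ?_, ?_, ?_⟩,
        Nat.add_le_add_left (Nat.add_le_add_right ht _) _⟩
      · simp [Expr.eval, h0']
      · simp [Function.update, h2']
      · simp [hm']
      · simp [ho', ho, List.range_succ]) (by
      rintro s₁ ⟨h0, h2, -, -⟩
      simp [Expr.eval, h0, h2]) (s := s) ⟨h0, h2, hm, by simp⟩
  refine ⟨s', t, hr, ho, ht.trans (le_of_eq ?_)⟩
  simp only [Expr.cost]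
  ring

end

theorem exists_program : ∃ (p : Prog) (C D : ℕ), ∀ ψ : PartitionedSAT, ∃ t,
    OutputsIn p ψ.encode (target ψ).encode t ∧ t ≤ C * (order (side ψ) + 1) ^ D := by
  classical
  obtain ⟨p₁, T₁, hT₁, hp₁⟩ := poly_k.2 2 le_rfl
  obtain ⟨p₂, T₂, hT₂, hp₂⟩ := poly_order.2 2 le_rfl
  obtain ⟨p₃, T₃, ⟨C, D, hT₃⟩, hp₃⟩ := polyDec_codeAdj.2 3 (by omega)
  have bound : PolyBound fun a => 2 + (T₁ a + (2 + (T₂ a + (2 +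
      (a.size * (a.size * (C * (a.size + 1) ^ D + 10) + 14) + 4))))) := by
    have hC : PolyBound fun a => C * (a.size + 1) ^ D := ⟨C, D, fun a => le_rfl⟩
    exact (PolyBound.const _).add <| hT₁.add <| (PolyBound.const _).add <| hT₂.add <|
      (PolyBound.const _).add <| PolyBound.add (.mul .size
        (.add (.mul .size (hC.add (.const _))) (.const _))) (.const _)
  obtain ⟨C', D', h⟩ := bound
  -- Register `0` starts with the input length and is cleared. The number of vertices stays in
  -- register `2` during the matrix loop, since `p₃` changes registers only from `3` on.
  refine ⟨.seq (.assign 0 (.const 0)) (.seq p₁ (.seq (.emit (.reg 2)) (.seq p₂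
    (.seq (.emit (.reg 2)) (matrixLoop p₃))))), C', D', fun ψ => ?_⟩
  have hpos : 0 < order (side ψ) := base_pos.trans_le (base_le_order _)
  let a : Input := ⟨ψ, 0, 0, hpos, hpos⟩
  let s₀ : State := { start ψ.encode with
    reg := Function.update (start ψ.encode).reg 0 ((Expr.const 0).eval (start ψ.encode)) }
  have rep₀ : a.Represents s₀ := by
    refine ⟨?_, ?_, ?_⟩
    · simp [s₀, a, Expr.eval]
    · simp [s₀, a, start]
    · simp only [s₀, start]
      rfl
  obtain ⟨s₁, t₁, hr₁, hs₁, hx₁, ht₁⟩ := hp₁ a s₀ rep₀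
  have rep₁ : a.Represents { s₁ with out := s₁.out ++ [(Expr.reg 2).eval s₁] } := by
    have := rep₀.same le_rfl hs₁
    exact ⟨this.reg_zero, this.reg_one, this.mem⟩
  obtain ⟨s₂, t₂, hr₂, hs₂, hx₂, ht₂⟩ := hp₂ a _ rep₁
  have rep₂ := rep₁.same le_rfl hs₂
  obtain ⟨s₃, t₃, hr₃, ho, ht₃⟩ := run_matrixLoop (n := order (side ψ)) (p := p₃)
    (τ := C * (order (side ψ) + 1) ^ D) (mem := a.mem)
    (A := fun i j => if CodeAdj ψ i j then 1 else 0) (by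
      intro i hi j hj s h0 h1 hm
      obtain ⟨s', t, hr, hs, hx, ht⟩ := hp₃ ⟨ψ, i, j, hi, hj⟩ s ⟨h0, h1, hm⟩
      exact ⟨s', t, hr, hs, hx, ht.trans (hT₃ _)⟩)
    (s := { s₂ with out := s₂.out ++ [(Expr.reg 2).eval s₂] }) rep₂.reg_zero hx₂ rep₂.mem
  refine ⟨_, ⟨s₃, .seq (.assign _ _ _) (.seq hr₁ (.seq (.emit _ _) (.seq hr₂
    (.seq (.emit _ _) hr₃)))), ?_⟩, le_trans ?_ (h a)⟩
  · rw [ho, hs₂.out, hs₁.out, encode_target]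
    simp [Expr.eval, hx₁, hx₂, s₀, start, a]
  · simp only [Expr.cost]
    have : a.size = order (side ψ) := rfl
    rw [this]
    omega

/-! ### Bounds in terms of `√N`. -/

theorem side_le_sqrt (ψ : PartitionedSAT) (hn : 1 ≤ ψ.n) :
    (side ψ : ℝ) ≤ 2 * √(ψ.numVars : ℝ) := by
  have h1 : ((side ψ : ℝ)) * side ψ ≤ 4 * ψ.n := by exact_mod_cast side_le ψ hn
  have h2 : (ψ.numVars : ℝ) = 3 * ψ.n := by simp [PartitionedSAT.numVars]
  have h3 : (0 : ℝ) ≤ ψ.n := Nat.cast_nonneg _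
  have h4 := Real.sq_sqrt (show (0 : ℝ) ≤ ψ.numVars from Nat.cast_nonneg _)
  refine abs_le_of_sq_le_sq' ?_ (by positivity) |>.2
  rw [mul_pow, h4, h2]
  nlinarith

theorem two_pow_le_rpow {ψ : PartitionedSAT} (hn : 1 ≤ ψ.n) {t K : ℕ} {c : ℝ}
    (ht : t ≤ 2 ^ (K * side ψ)) (hc : 2 * (K : ℝ) ≤ c) :
    (t : ℝ) ≤ 2 ^ (c * √(ψ.numVars : ℝ)) := by
  have h1 : (t : ℝ) ≤ (2 : ℝ) ^ ((K * side ψ : ℕ) : ℝ) := by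
    rw [Real.rpow_natCast]
    exact_mod_cast ht
  refine h1.trans (Real.rpow_le_rpow_of_exponent_le (by norm_num) ?_)
  push_cast
  have h2 := side_le_sqrt ψ hn
  calc (K : ℝ) * side ψ ≤ K * (2 * √(ψ.numVars : ℝ)) := by gcongr
    _ = (2 * K) * √(ψ.numVars : ℝ) := by ring
    _ ≤ c * √(ψ.numVars : ℝ) := by gcongr

theorem order_le (ψ : PartitionedSAT) : order (side ψ) ≤ 2 ^ (76 * side ψ) := by
  have := one_le_side ψ
  rw [order, base_pow_five, ← pow_succ']
  exact Nat.pow_le_pow_right (by norm_num) (by omega)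

theorem poly_order_le (ψ : PartitionedSAT) (C D : ℕ) :
    C * (order (side ψ) + 1) ^ D ≤ 2 ^ ((C + 77 * D) * side ψ) := by
  have hb := one_le_side ψ
  have h1 : order (side ψ) + 1 ≤ 2 ^ (77 * side ψ) := by
    have h2 := order_le ψ
    have h3 : 2 ^ (76 * side ψ + 1) ≤ 2 ^ (77 * side ψ) :=
      Nat.pow_le_pow_right (by norm_num) (by omega)
    have h4 := Nat.one_le_two_pow (n := 76 * side ψ)
    rw [pow_succ] at h3
    omega
  have h2 : C ≤ 2 ^ (C * side ψ) := Nat.lt_two_pow_self.le.trans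
    (Nat.pow_le_pow_right (by norm_num) (Nat.le_mul_of_pos_right _ hb))
  calc C * (order (side ψ) + 1) ^ D
      ≤ 2 ^ (C * side ψ) * (2 ^ (77 * side ψ)) ^ D :=
        Nat.mul_le_mul h2 (Nat.pow_le_pow_left h1 D)
    _ = 2 ^ ((C + 77 * D) * side ψ) := by rw [← pow_mul, ← pow_add]; ring_nf

end MetricReduction

open MetricReduction in
theorem theorem3 :
    ∃ (p : RAM.Prog) (c : ℝ), ∀ ψ : PartitionedSAT, 1 ≤ ψ.numVars →
      ∃ (I : MetricDimensionInstance) (t vc : ℕ),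
        RAM.OutputsIn p ψ.encode I.encode t ∧
        (t : ℝ) ≤ 2 ^ (c * √(ψ.numVars : ℝ)) ∧
        (ψ.Satisfiable ↔ I.IsYes) ∧
        I.graph.vertexCoverNum = (vc : ℕ∞) ∧
        (vc : ℝ) + (I.k : ℝ) ≤ c * √(ψ.numVars : ℝ) ∧
        (I.numVerts : ℝ) ≤ 2 ^ (c * √(ψ.numVars : ℝ)) := by
  obtain ⟨p, C, D, hp⟩ := exists_program
  -- With `b ≤ 2 * √N`, the first summand bounds the running time, and `600` serves both `vc + k ≤
  -- 300 * b` and the exponent `76 * b` of the number of vertices.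
  refine ⟨p, 2 * ((C + 77 * D : ℕ) : ℝ) + 600, fun ψ hψ => ?_⟩
  have hn : 1 ≤ ψ.n := by
    unfold PartitionedSAT.numVars at hψ
    omega
  obtain ⟨t, ht, htb⟩ := hp ψ
  obtain ⟨vc, hvc, hvcb⟩ := exists_vertexCoverNum_eq ψ
  refine ⟨target ψ, t, vc, ht, two_pow_le_rpow hn (htb.trans (poly_order_le ψ C D)) (by simp),
    satisfiable_iff_isYes ψ, hvc, ?_, ?_⟩
  · have hk : vc + (target ψ).k ≤ 300 * side ψ := by
      have := one_le_side ψ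
      simp only [target]
      omega
    have hk' : (vc : ℝ) + ((target ψ).k : ℝ) ≤ 300 * (side ψ : ℝ) := by exact_mod_cast hk
    have hs := side_le_sqrt ψ hn
    have : (0 : ℝ) ≤ ((C + 77 * D : ℕ) : ℝ) * √(ψ.numVars : ℝ) := by positivity
    nlinarith
  · refine two_pow_le_rpow hn (order_le ψ) ?_
    have : (0 : ℝ) ≤ ((C + 77 * D : ℕ) : ℝ) := Nat.cast_nonneg _
    push_cast at *
    linarith
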